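/- Let $d\ge 1$, $R_0\in(0,\infty]$, $\kappa,K_0\ge 1$, $c_L\in(0,1)$, $c_U\ge 1$, $\gamma\in(0,2)$, and write $B_\rho=\{x\in\mathbb{R}^d:|x|<\rho\}$. Let $\ell\colon(0,R_0)\to(0,\infty)$ be a measurable function such that $$\int_0^{R_0}\ell(s)\,\frac{ds}{s}=\infty,\qquad \int_r^{R_0}\ell(s)\,\frac{ds}{s}<\infty\quad(0<r<R_0),$$ and $$c_L\lambda^{-\gamma}\le\frac{\ell(\lambda r)}{\ell(r)}\le c_U\lambda^{d}\qquad\text{for all } r>0 \text{ and } 1\le\lambda<\frac{R_0}{r}.$$ Set $L(r)=\int_r^{R_0}\ell(s)\,\frac{ds}{s}$ for $0<r<R_0$. Consider measurable kernels $K\colon\mathbb{R}^d\times(\mathbb{R}^d\setminus\{0\})\to[0,\infty)$ with $K(x,h)=K(x,-h)$ for all $x,h$ and $$\kappa^{-1}|h|^{-d}\ell(|h|)\le K(x,h)\le\kappa|h|^{-d}\ell(|h|)\quad\text{for } x\in\mathbb{R}^d,\ 0<|h|<R_0,\tag{A$_1$}$$ $$\sup_{x\in\mathbb{R}^d}\int_{\mathbb{R}^d\setminus\{0\}}(1\wedge|h|^2)\,K(x,h)\,dh\le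 K_0.\tag{K$_0$}$$ For such $K$ and for $u\in C^2_b(\mathbb{R}^d)$, i.e. $u$ continuous and bounded together with its first and second derivatives, let $$Au(x)=\int_{\mathbb{R}^d\setminus\{0\}}\big(u(x+h)-u(x)-\langle\nabla u(x),h\rangle\mathbb{1}_{B_1}(h)\big)K(x,h)\,dh .$$ Theorem. There exist constants $c>0$ and $\beta\in(0,1)$, depending only on $d,R_0,\kappa,K_0,\ell,c_L,c_U,\gamma$, such that for every kernel $K$ as above, every $r>0$ with $r\le R_0/2$ (every $r>0$ if $R_0=\infty$), every $f\in L^\infty(B_r)$ and every $u\in C^2_b(\mathbb{R}^d)$ satisfying $Au=f$ almost everywhere in $B_r$, $$\sup_{x,y\in B_{r/4},\,x\ne y}|u(x)-u(y)|\,L(|x-y|)^{\beta}\le c\,L(r)^{\beta}\,\|u\|_\infty+c\,L(r)^{\beta-1}\,\|f\|_{L^\infty(B_r)} .$$ Here $\|u\|_\infty=\sup_{\mathbb{R}^d}|u|$, and $\|f\|_{L^\infty(B_r)}$ is the essential supremum of $|f|$ over $B_r$. -/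

import Mathlib

open MeasureTheory
open scoped ENNReal

namespace NonlocalReg

/-- The interval `(0, R₀)` of real numbers, where `R₀ ∈ (0, ∞]`. -/
def scaleInterval (R₀ : ℝ≥0∞) : Set ℝ := {s | 0 < s ∧ ENNReal.ofReal s < R₀}

/-- The interval `(r, R₀)` of real numbers, where `R₀ ∈ (0, ∞]`. -/
def tailInterval (R₀ : ℝ≥0∞) (r : ℝ) : Set ℝ := {s | r < s ∧ ENNReal.ofReal s < R₀}

/-- The assumptions on the (measurable) function `ℓ : (0, R₀) → (0, ∞)`.
Values of `ℓ` outside `(0, R₀)` are irrelevant. -/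
structure IsScale (d : ℕ) (R₀ : ℝ≥0∞) (ell : ℝ → ℝ) (cL cU γ : ℝ) : Prop where
  cL_pos : 0 < cL
  cL_lt_one : cL < 1
  one_le_cU : 1 ≤ cU
  γ_pos : 0 < γ
  γ_lt_two : γ < 2
  measurable : Measurable ((scaleInterval R₀).domRestrict ell)
  pos : ∀ s ∈ scaleInterval R₀, 0 < ell s
  lintegral_eq_top : ∫⁻ s in scaleInterval R₀, ENNReal.ofReal (ell s / s) = ⊤
  lintegral_tail_lt_top : ∀ r ∈ scaleInterval R₀,
    ∫⁻ s in tailInterval R₀ r, ENNReal.ofReal (ell s / s) < ⊤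
  lower_scaling : ∀ r lam : ℝ, 0 < r → 1 ≤ lam → ENNReal.ofReal (r * lam) < R₀ →
    cL * lam ^ (-γ) ≤ ell (r * lam) / ell r
  upper_scaling : ∀ r lam : ℝ, 0 < r → 1 ≤ lam → ENNReal.ofReal (r * lam) < R₀ →
    ell (r * lam) / ell r ≤ cU * lam ^ d

/-- The intrinsic scale `L(r) = ∫_r^{R₀} ℓ(s) / s ds`, for `0 < r < R₀`. -/
noncomputable def scaleL (R₀ : ℝ≥0∞) (ell : ℝ → ℝ) (r : ℝ) : ℝ :=
  ∫ s in tailInterval R₀ r, ell s / s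

/-- The assumptions on the kernel `K : ℝᵈ × (ℝᵈ ∖ {0}) → [0, ∞)`: measurability, symmetry in the
second variable, comparability with `|h|^{-d} ℓ(|h|)` for `0 < |h| < R₀`, and the uniform
Lévy bound. Values `K x 0` are irrelevant. -/
structure IsKernel (d : ℕ) (R₀ : ℝ≥0∞) (ell : ℝ → ℝ) (κ K₀ : ℝ)
    (K : EuclideanSpace ℝ (Fin d) → EuclideanSpace ℝ (Fin d) → ℝ) : Prop where
  measurable : Measurable
    ({p : EuclideanSpace ℝ (Fin d) × EuclideanSpace ℝ (Fin d) | p.2 ≠ 0}.domRestrict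
      (Function.uncurry K))
  nonneg : ∀ x h, h ≠ 0 → 0 ≤ K x h
  symm : ∀ x h, h ≠ 0 → K x (-h) = K x h
  lower_bound : ∀ x h, h ≠ 0 → ENNReal.ofReal ‖h‖ < R₀ →
    κ⁻¹ * (ell ‖h‖ / ‖h‖ ^ d) ≤ K x h
  upper_bound : ∀ x h, h ≠ 0 → ENNReal.ofReal ‖h‖ < R₀ →
    K x h ≤ κ * (ell ‖h‖ / ‖h‖ ^ d)
  levy_bound : ∀ x, ∫⁻ h in {h : EuclideanSpace ℝ (Fin d) | h ≠ 0},
    ENNReal.ofReal (min 1 (‖h‖ ^ 2) * K x h) ≤ ENNReal.ofReal K₀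

/-- The class `C²_b(ℝᵈ)`: twice continuously differentiable functions which are bounded together
with their first and second derivatives. -/
structure IsC2b {d : ℕ} (u : EuclideanSpace ℝ (Fin d) → ℝ) : Prop where
  contDiff : ContDiff ℝ 2 u
  bounded : ∃ C : ℝ, ∀ k : ℕ, k ≤ 2 → ∀ x, ‖iteratedFDeriv ℝ k u x‖ ≤ C

/-- The operator
`A u (x) = ∫_{ℝᵈ ∖ {0}} (u(x+h) - u(x) - ⟨∇u(x), h⟩ 1_{B_1}(h)) K(x,h) dh`. -/
noncomputable def nonlocalOp {d : ℕ}
    (K : EuclideanSpace ℝ (Fin d) → EuclideanSpace ℝ (Fin d) → ℝ)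
    (u : EuclideanSpace ℝ (Fin d) → ℝ) (x : EuclideanSpace ℝ (Fin d)) : ℝ :=
  ∫ h in {h : EuclideanSpace ℝ (Fin d) | h ≠ 0},
    (u (x + h) - u x
      - (Metric.ball (0 : EuclideanSpace ℝ (Fin d)) 1).indicator
          (fun h => inner ℝ (gradient u x) h) h) * K x h

end NonlocalReg

/-! Write ν for the measure |h|^{-d} ℓ(|h|) dh on B_{R₀}. Symmetry of K turns 2Au into an integral
of second differences of u against K(x,·). Comparability of K with ν then replaces the equation by
two extremal inequalities ∫ `pucci κ` (±δu) dν ≥ -G, which no longer involve K. Jumps longer than R₀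
carry mass at most T·L(r) and only enlarge G (`IsKernel.extremal_inequalities`).

The ν-mass outside B_s is a constant times L(s). Since L may grow very slowly at 0, for instance
logarithmically, geometric radii need not give annuli of useful mass. The radii are instead chosen
by L(r_n) = a^n L(ρ). The annulus 4r_{n+1} ≤ |y| < r_n then carries mass comparable to a^n L(ρ), and
so does the tail outside B_{r_n/2}. By the scaling bounds this also controls the normalized
truncated second moment at r_{n+1}, and the annulus looks the same up to constants from every point
of B_{2r_{n+1}} (`IsScale.exists_scaleSequence`).

For any level c, one of {u ≤ c} and {u > c} fills half of that annulus. Jumps into this set push u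
away from one extreme of its range on B_{r_{n+1}}: at a maximum point of the normalized function
plus a small bump, the extremal inequality would fail (`le_one_sub_of_subsolution`). Hence the
oscillation drops by a factor b > 1 per step, while the growth admitted outside the balls stays
integrable because 2b ≤ a (`IsScaleSequence.oscillation_decay`). As L grows by a while the
oscillation shrinks by b, the modulus is L^{-β} with β = log_a b < 1 (`IsScale.regularity_at_zero`).
Translation gives the theorem. -/

namespace NonlocalReg

/-! ### The growth lemma for extremal inequalities. -/

section Oscillation

variable {E : Type*} [NormedAddCommGroup E]

/-- The symmetric second difference of `u` at `x` in direction `h`. -/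
def secondDiff (u : E → ℝ) (x h : E) : ℝ := u (x + h) + u (x - h) - 2 * u x

/-- The one-dimensional extremal function `t ↦ κ t⁺ - κ⁻¹ t⁻` (for `κ ≥ 1`). -/
noncomputable def pucci (κ t : ℝ) : ℝ := max (κ * t) (κ⁻¹ * t)

/-- The gain a is charged at the worst rate κ and the loss b is credited only at the worst rate κ⁻¹.
-/
theorem pucci_le {κ t a b : ℝ} (hκ : 1 ≤ κ) (ha : 0 ≤ a) (hb : 0 ≤ b) (h : t ≤ a - b) :
    pucci κ t ≤ κ * a - κ⁻¹ * b := by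
  have h0 : 0 < κ := by linarith
  have h1 : κ⁻¹ ≤ 1 := inv_le_one_of_one_le₀ hκ
  have h2 : 0 < κ⁻¹ := inv_pos.2 h0
  refine max_le ?_ ?_
  · nlinarith [mul_le_mul_of_nonneg_left h h0.le]
  · nlinarith [mul_le_mul_of_nonneg_left h h2.le]

theorem abs_pucci_le {κ : ℝ} (hκ : 1 ≤ κ) (t : ℝ) : |pucci κ t| ≤ κ * |t| := by
  have h0 : 0 < κ := by linarith
  have h1 : κ⁻¹ ≤ 1 := inv_le_one_of_one_le₀ hκ
  have h2 : 0 < κ⁻¹ := inv_pos.2 h0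
  have h3 : |κ * t| = κ * |t| := by rw [abs_mul, abs_of_pos h0]
  have h4 : |κ⁻¹ * t| ≤ κ * |t| := by
    rw [abs_mul, abs_of_pos h2]
    exact mul_le_mul_of_nonneg_right (by linarith) (abs_nonneg t)
  exact (abs_max_le_max_abs_abs).trans (max_le h3.le h4)

theorem continuous_pucci (κ : ℝ) : Continuous (pucci κ) := by
  unfold pucci; fun_prop

theorem pucci_mul {κ c : ℝ} (hc : 0 ≤ c) (t : ℝ) : pucci κ (c * t) = c * pucci κ t := by
  unfold pucci
  rw [mul_max_of_nonneg _ _ hc]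
  congr 1 <;> ring

/-- A compactly supported, semiconvex, radial bump function. -/
noncomputable def quadBump (ρ : ℝ) (x : E) : ℝ := max 0 ((4 - ‖x‖ ^ 2 / ρ ^ 2) / 3)

theorem quadBump_nonneg (ρ : ℝ) (x : E) : 0 ≤ quadBump ρ x := le_max_left _ _

theorem one_le_quadBump {ρ : ℝ} (hρ : 0 < ρ) {x : E} (hx : ‖x‖ ≤ ρ) : 1 ≤ quadBump ρ x := by
  refine le_max_of_le_right ?_
  have : ‖x‖ ^ 2 / ρ ^ 2 ≤ 1 := by
    rw [div_le_one (by positivity)]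
    exact pow_le_pow_left₀ (norm_nonneg x) hx 2
  linarith

theorem quadBump_eq_zero {ρ : ℝ} (hρ : 0 < ρ) {x : E} (hx : 2 * ρ ≤ ‖x‖) :
    quadBump ρ x = 0 := by
  refine max_eq_left ?_
  have : 4 ≤ ‖x‖ ^ 2 / ρ ^ 2 := by
    rw [le_div_iff₀ (by positivity)]
    nlinarith
  linarith

theorem quadBump_le (ρ : ℝ) (x : E) : quadBump ρ x ≤ 4 / 3 := by
  refine max_le (by norm_num) ?_
  have : 0 ≤ ‖x‖ ^ 2 / ρ ^ 2 := by positivity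
  linarith

theorem continuous_quadBump (ρ : ℝ) : Continuous (quadBump ρ : E → ℝ) := by
  unfold quadBump; fun_prop

theorem integral_comp_sub_eq [MeasurableSpace E] [BorelSpace E] {ν : Measure E}
    [ν.IsNegInvariant] (f : E → ℝ) (x : E) :
    ∫ h, f (x - h) ∂ν = ∫ h, f (x + h) ∂ν := by
  simpa [sub_eq_add_neg] using integral_neg_eq_self (fun h => f (x + h)) ν

variable [InnerProductSpace ℝ E]

/-- The bump is a maximum of 0 and a paraboloid. Where it vanishes at x its second differences are
nonnegative. Elsewhere the paraboloid touches it from below at x, and the parallelogram law computes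
the second difference of the paraboloid. Only a lower bound is needed, so the kink is harmless. -/
theorem neg_secondDiff_quadBump_le (ρ : ℝ) (x h : E) :
    -secondDiff (quadBump ρ) x h ≤ 2 / 3 * min 4 (‖h‖ ^ 2 / ρ ^ 2) := by
  have h1 := quadBump_nonneg ρ (x + h)
  have h2 := quadBump_nonneg ρ (x - h)
  have h3 := quadBump_le ρ x
  have h5 : 0 ≤ ‖h‖ ^ 2 / ρ ^ 2 := by positivity
  unfold secondDiff
  rcases min_choice 4 (‖h‖ ^ 2 / ρ ^ 2) with h4 | h4 <;> rw [h4]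
  · linarith
  · rcases max_choice 0 ((4 - ‖x‖ ^ 2 / ρ ^ 2) / 3) with h6 | h6
    · have : quadBump ρ x = 0 := h6
      linarith
    · have e0 : quadBump ρ x = (4 - ‖x‖ ^ 2 / ρ ^ 2) / 3 := h6
      have e1 : (4 - ‖x + h‖ ^ 2 / ρ ^ 2) / 3 ≤ quadBump ρ (x + h) := le_max_right _ _
      have e2 : (4 - ‖x - h‖ ^ 2 / ρ ^ 2) / 3 ≤ quadBump ρ (x - h) := le_max_right _ _
      have e3 : ‖x + h‖ ^ 2 / ρ ^ 2 + ‖x - h‖ ^ 2 / ρ ^ 2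
          = 2 * (‖x‖ ^ 2 / ρ ^ 2) + 2 * (‖h‖ ^ 2 / ρ ^ 2) := by
        have := parallelogram_law_with_norm ℝ x h
        rw [← add_div, ← mul_div_assoc, ← mul_div_assoc, ← add_div]
        congr 1
        nlinarith
      linarith

variable [MeasurableSpace E] [BorelSpace E]

/-- Growth lemma: a subsolution which is at most `1` in `B_ρ`, and nonpositive on a set of large
measure seen from `B_{2ρ'}`, is at most `1 - θ` in the smaller ball `B_{ρ'}`. -/
theorem le_one_sub_of_subsolution [ProperSpace E] {ν : Measure E} [ν.IsNegInvariant]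
    {κ ρ' p e q g θ : ℝ} {v Ex : E → ℝ} {A : Set E} (hκ : 1 ≤ κ)
    (hρ' : 0 < ρ') (hv : Continuous v) (hE : ∀ y, 0 ≤ Ex y)
    (hvE : ∀ y, v y ≤ 1 + Ex y)
    (hEi : ∀ x : E, ‖x‖ ≤ 2 * ρ' → Integrable (fun h => Ex (x + h)) ν)
    (hEe : ∀ x : E, ‖x‖ ≤ 2 * ρ' → ∫ h, Ex (x + h) ∂ν ≤ e)
    (hA : MeasurableSet A) (hAρ : ∀ y ∈ A, 4 * ρ' ≤ ‖y‖) (hAv : ∀ y ∈ A, v y ≤ 0)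
    (hAfin : ∀ x : E, ‖x‖ ≤ 2 * ρ' → ν ((x + ·) ⁻¹' A) ≠ ⊤)
    (hAg : ∀ x : E, ‖x‖ ≤ 2 * ρ' → g ≤ ν.real ((x + ·) ⁻¹' A))
    (hqi : Integrable (fun h : E => min 4 (‖h‖ ^ 2 / ρ' ^ 2)) ν)
    (hq : ∫ h : E, min 4 (‖h‖ ^ 2 / ρ' ^ 2) ∂ν ≤ q)
    (hpi : ∀ x : E, ‖x‖ ≤ 2 * ρ' → Integrable (fun h => pucci κ (secondDiff v x h)) ν)
    (hp : ∀ x : E, ‖x‖ ≤ 2 * ρ' → -p ≤ ∫ h, pucci κ (secondDiff v x h) ∂ν)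
    (hθ : 0 ≤ θ) (hsmall : p + κ * (2 * e + θ * q) < κ⁻¹ * (2 * g)) :
    ∀ x : E, ‖x‖ ≤ ρ' → v x ≤ 1 - θ := by
  intro x₀ hx₀
  by_contra! hcon
  -- If v exceeds 1 - θ somewhere in the small ball, then w exceeds 1 there. Its maximum over the
  -- ball of radius 2ρ' also dominates w outside up to `Ex`, since the bump vanishes there and v ≤ 1
  -- + `Ex`.
  set w : E → ℝ := fun y => v y + θ * quadBump ρ' y with hw
  have hwc : Continuous w := hv.add (continuous_const.mul (continuous_quadBump ρ'))
  obtain ⟨x, hx, hmax⟩ := (isCompact_closedBall (0 : E) (2 * ρ')).exists_isMaxOn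
    ⟨0, Metric.mem_closedBall_self (by positivity)⟩ hwc.continuousOn
  have hx' : ‖x‖ ≤ 2 * ρ' := by simpa using hx
  have hmax' : ∀ y : E, ‖y‖ ≤ 2 * ρ' → w y ≤ w x := fun y hy => hmax (by simpa using hy)
  have hwx : 1 < w x := by
    refine lt_of_lt_of_le ?_ (hmax' x₀ (by linarith))
    have := mul_le_mul_of_nonneg_left (one_le_quadBump hρ' hx₀) hθ
    simp only [hw]; linarith
  -- The set A lies off the support of the bump, where w = v ≤ 0 < 1 < w x, so a jump into A loses
  -- at least one unit.
  have key : ∀ y, w y - w x ≤ Ex y - A.indicator 1 y := by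
    intro y
    by_cases hy : y ∈ A
    · have h1 := hAρ y hy
      have h2 := hAv y hy
      have h3 := hE y
      rw [Set.indicator_of_mem hy]
      have : w y = v y := by
        simp only [hw]; rw [quadBump_eq_zero hρ' (by linarith)]; ring
      simp only [Pi.one_apply]
      linarith
    · rw [Set.indicator_of_notMem hy]
      by_cases hy2 : ‖y‖ ≤ 2 * ρ'
      · linarith [hmax' y hy2, hE y]
      · have : w y = v y := by
          simp only [hw]; rw [quadBump_eq_zero hρ' (by linarith)]; ring
        linarith [hvE y]
  have hpt : ∀ h, pucci κ (secondDiff v x h) ≤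
      κ * (Ex (x + h) + Ex (x - h) + θ * min 4 (‖h‖ ^ 2 / ρ' ^ 2))
        - κ⁻¹ * (A.indicator 1 (x + h) + A.indicator 1 (x - h)) := by
    intro h
    have i1 : ∀ y, (0 : ℝ) ≤ A.indicator 1 y := Set.indicator_nonneg (fun _ _ => zero_le_one)
    have m1 : 0 ≤ min 4 (‖h‖ ^ 2 / ρ' ^ 2) := le_min (by norm_num) (by positivity)
    refine pucci_le hκ (add_nonneg (add_nonneg (hE _) (hE _)) (mul_nonneg hθ m1))
      (add_nonneg (i1 _) (i1 _)) ?_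
    have h1 := key (x + h)
    have h2 := key (x - h)
    have h3 := mul_le_mul_of_nonneg_left (neg_secondDiff_quadBump_le ρ' x h) hθ
    have h4 := mul_nonneg hθ m1
    simp only [hw] at h1 h2
    unfold secondDiff at h3 ⊢
    linarith
  have hAm : ∀ y : E, MeasurableSet ((y + ·) ⁻¹' A) := fun y => (measurable_const_add y) hA
  have ind_eq : (fun h => A.indicator (1 : E → ℝ) (x + h)) = ((x + ·) ⁻¹' A).indicator 1 := by
    rfl
  have iA : Integrable (fun h => A.indicator (1 : E → ℝ) (x + h)) ν := by
    rw [ind_eq, integrable_indicator_iff (hAm x)]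
    exact integrableOn_const (hAfin x hx')
  have iE := hEi x hx'
  have iA' : Integrable (fun h => A.indicator (1 : E → ℝ) (x - h)) ν := by
    simpa [sub_eq_add_neg] using iA.comp_neg
  have iE' : Integrable (fun h => Ex (x - h)) ν := by
    simpa [sub_eq_add_neg] using iE.comp_neg
  have hIA : g ≤ ∫ h, A.indicator (1 : E → ℝ) (x + h) ∂ν := by
    rw [ind_eq, integral_indicator_one (hAm x)]
    exact hAg x hx'
  have iB : Integrable (fun h => κ * (Ex (x + h) + Ex (x - h) + θ * min 4 (‖h‖ ^ 2 / ρ' ^ 2))) ν :=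
    ((iE.add iE').add (hqi.const_mul θ)).const_mul κ
  have iC : Integrable (fun h => κ⁻¹ * (A.indicator (1 : E → ℝ) (x + h)
      + A.indicator (1 : E → ℝ) (x - h))) ν := (iA.add iA').const_mul κ⁻¹
  have iD : Integrable (fun h => Ex (x + h) + Ex (x - h)) ν := iE.add iE'
  have hmono := integral_mono (hpi x hx') (iB.sub iC) hpt
  have hval : ∫ h, (κ * (Ex (x + h) + Ex (x - h) + θ * min 4 (‖h‖ ^ 2 / ρ' ^ 2))
        - κ⁻¹ * (A.indicator 1 (x + h) + A.indicator 1 (x - h))) ∂ν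
      = κ * (2 * (∫ h, Ex (x + h) ∂ν) + θ * ∫ h : E, min 4 (‖h‖ ^ 2 / ρ' ^ 2) ∂ν)
        - κ⁻¹ * (2 * ∫ h, A.indicator (1 : E → ℝ) (x + h) ∂ν) := by
    rw [integral_sub iB iC, integral_const_mul, integral_const_mul,
      integral_add iD (hqi.const_mul θ), integral_add iE iE', integral_add iA iA',
      integral_const_mul, integral_comp_sub_eq Ex x, integral_comp_sub_eq (A.indicator 1) x]
    ring
  have h0 : 0 < κ := by linarith
  have h2 : 0 < κ⁻¹ := inv_pos.2 h0
  have f1 := hp x hx'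
  have f2 := hEe x hx'
  have f3 := mul_le_mul_of_nonneg_left hq hθ
  have f4 := mul_le_mul_of_nonneg_left (add_le_add (mul_le_mul_of_nonneg_left f2 zero_le_two) f3)
    h0.le
  have f5 := mul_le_mul_of_nonneg_left (mul_le_mul_of_nonneg_left hIA zero_le_two) h2.le
  have f6 : ∫ h, pucci κ (secondDiff v x h) ∂ν ≤ _ := hmono.trans_eq hval
  linarith

end Oscillation

/-! ### Oscillation decay along a sequence of scales. -/

section Iteration

variable {E : Type*} [NormedAddCommGroup E]

/-- The growth allowed outside of the `n`-th ball in the oscillation decay. -/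
noncomputable def growthExcess (b : ℝ) (r : ℕ → ℝ) : ℕ → E → ℝ
  | 0, _ => 0
  | n + 1, y => b * growthExcess b r n y + 2 * (b - 1) * {z : E | r (n + 1) ≤ ‖z‖}.indicator 1 y

theorem growthExcess_nonneg {b : ℝ} (hb : 1 ≤ b) (r : ℕ → ℝ) (n : ℕ) (y : E) :
    0 ≤ growthExcess b r n y := by
  induction n with
  | zero => exact le_rfl
  | succ n ih =>
    have h1 : 0 ≤ {z : E | r (n + 1) ≤ ‖z‖}.indicator (1 : E → ℝ) y :=
      Set.indicator_nonneg (fun _ _ => zero_le_one) y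
    have h2 : 0 ≤ b * growthExcess b r n y := mul_nonneg (by linarith) ih
    have h3 : 0 ≤ 2 * (b - 1) * {z : E | r (n + 1) ≤ ‖z‖}.indicator (1 : E → ℝ) y :=
      mul_nonneg (by linarith) h1
    exact add_nonneg h2 h3

theorem growthExcess_eq_zero (b : ℝ) {r : ℕ → ℝ} (hr : Antitone r) (n : ℕ) {y : E}
    (hy : ‖y‖ < r n) : growthExcess b r n y = 0 := by
  induction n with
  | zero => rfl
  | succ n ih =>
    have h1 : y ∉ {z : E | r (n + 1) ≤ ‖z‖} := by simpa using hy
    simp [growthExcess, ih (hy.trans_le (hr n.le_succ)), h1]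

theorem preimage_tail_subset {x : E} {s t : ℝ} (hx : ‖x‖ ≤ s - t) :
    (x + ·) ⁻¹' {y : E | s ≤ ‖y‖} ⊆ {h | t ≤ ‖h‖} := by
  intro h hh
  have h1 : s ≤ ‖x + h‖ := hh
  have h2 := norm_add_le x h
  show t ≤ ‖h‖
  linarith

theorem integrable_pucci {α : Type*} [MeasurableSpace α] {ν : Measure α} {κ : ℝ} (hκ : 1 ≤ κ)
    {f : α → ℝ} (hf : Integrable f ν) :
    Integrable (fun h => pucci κ (f h)) ν :=
  (hf.norm.const_mul κ).mono' ((continuous_pucci κ).comp_aestronglyMeasurable hf.1)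
    (Filter.Eventually.of_forall fun h => abs_pucci_le hκ (f h))

variable [MeasurableSpace E]

/-- A sequence of radii along which the jump measure `ν` has tails growing like `a ^ n`, and such
that the annuli between consecutive balls carry a fixed portion of the mass, also when seen from
points close to the origin. -/
structure IsScaleSequence (ν : Measure E) (r : ℕ → ℝ) (a N C₁ C₂ g : ℝ) : Prop where
  pos : ∀ n, 0 < r n
  four_mul_le : ∀ n, 4 * r (n + 1) ≤ r n
  tail_ne_top : ∀ s, 0 < s → ν {h | s ≤ ‖h‖} ≠ ⊤
  tail_le : ∀ n, ν.real {h | r n / 2 ≤ ‖h‖} ≤ C₁ * (a ^ n * N)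
  integrable : ∀ n, Integrable (fun h : E => min 4 (‖h‖ ^ 2 / r (n + 1) ^ 2)) ν
  integral_le : ∀ n, ∫ h : E, min 4 (‖h‖ ^ 2 / r (n + 1) ^ 2) ∂ν ≤ C₂ * (a ^ n * N)
  half_mass : ∀ n, ∀ S : Set E, MeasurableSet S →
    (∀ x : E, ‖x‖ ≤ 2 * r (n + 1) →
      g * (a ^ n * N) ≤ ν.real ((x + ·) ⁻¹' (S ∩ {y | 4 * r (n + 1) ≤ ‖y‖}))) ∨
    (∀ x : E, ‖x‖ ≤ 2 * r (n + 1) →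
      g * (a ^ n * N) ≤ ν.real ((x + ·) ⁻¹' (Sᶜ ∩ {y | 4 * r (n + 1) ≤ ‖y‖})))

variable {ν : Measure E} {r : ℕ → ℝ} {a N C₁ C₂ g : ℝ}

theorem IsScaleSequence.antitone (H : IsScaleSequence ν r a N C₁ C₂ g) : Antitone r :=
  antitone_nat_of_succ_le fun n => by
    have := H.four_mul_le n
    have := H.pos (n + 1)
    linarith

theorem IsScaleSequence.two_mul_le (H : IsScaleSequence ν r a N C₁ C₂ g) (n : ℕ) :
    2 * r (n + 1) ≤ r n / 2 := by
  linarith [H.four_mul_le n]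

variable [BorelSpace E]

/-- The integrals satisfy I_{n+1} ≤ b I_n + 2(b-1) C₁ a^{n+1} N. The claimed bound propagates
because 4b + 2a ≤ 4a, which is the condition 2b ≤ a. The factor b - 1 makes the excess negligible
for b close to 1. -/
theorem IsScaleSequence.growthExcess_integral (H : IsScaleSequence ν r a N C₁ C₂ g) {b : ℝ}
    (hb : 1 ≤ b) (hab : 2 * b ≤ a) (hN : 0 ≤ N) (hC₁ : 0 ≤ C₁) (n : ℕ) (x : E)
    (hx : ‖x‖ ≤ r n / 2) :
    Integrable (fun h => growthExcess b r n (x + h)) ν ∧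
      ∫ h, growthExcess b r n (x + h) ∂ν ≤ 4 * (b - 1) * C₁ * (a ^ n * N) := by
  induction n with
  | zero =>
    have : 0 ≤ 4 * (b - 1) * C₁ * (a ^ 0 * N) := by
      have : 0 ≤ b - 1 := by linarith
      positivity
    simpa [growthExcess] using this
  | succ n ih =>
    obtain ⟨i1, i2⟩ := ih (hx.trans (by linarith [H.antitone n.le_succ]))
    set T : Set E := (x + ·) ⁻¹' {y : E | r (n + 1) ≤ ‖y‖} with hT
    have hTm : MeasurableSet T :=
      (measurable_const_add x) (measurableSet_le measurable_const measurable_norm)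
    have hsub : T ⊆ {h | r (n + 1) / 2 ≤ ‖h‖} := preimage_tail_subset (by linarith)
    have hfin := H.tail_ne_top (r (n + 1) / 2) (half_pos (H.pos _))
    have hTi : Integrable (T.indicator (1 : E → ℝ)) ν := by
      rw [integrable_indicator_iff hTm]
      exact integrableOn_const (measure_ne_top_of_subset hsub hfin)
    have hTr : ν.real T ≤ C₁ * (a ^ (n + 1) * N) :=
      (measureReal_mono hsub hfin).trans (H.tail_le (n + 1))
    have e : (fun h => growthExcess b r (n + 1) (x + h)) =
        fun h => b * growthExcess b r n (x + h) + 2 * (b - 1) * T.indicator 1 h := rfl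
    refine ⟨?_, ?_⟩
    · rw [e]; exact (i1.const_mul b).add (hTi.const_mul _)
    · rw [e, integral_add (i1.const_mul b) (hTi.const_mul _), integral_const_mul,
        integral_const_mul, integral_indicator_one hTm]
      have h1 : 0 ≤ b - 1 := by linarith
      have h2 := mul_le_mul_of_nonneg_left i2 (by linarith : 0 ≤ b)
      have h3 := mul_le_mul_of_nonneg_left hTr (by linarith : 0 ≤ 2 * (b - 1))
      have h4 : 0 ≤ 2 * (b - 1) * C₁ * (a ^ n * N) * (a - 2 * b) := by
        have : 0 ≤ a - 2 * b := by linarith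
        have : 0 ≤ a := by linarith
        positivity
      rw [pow_succ] at h3 ⊢
      nlinarith

variable [InnerProductSpace ℝ E] [ProperSpace E] [ν.IsNegInvariant]

/-- The growth lemma applied to (b^n/D)(u - c), with all masses at level n measured in units of a^n
N. The smallness condition thus becomes independent of n. -/
theorem IsScaleSequence.one_sided_step (H : IsScaleSequence ν r a N C₁ C₂ g)
    {κ b p θ D c : ℝ} {u : E → ℝ} (hκ : 1 ≤ κ) (hb : 1 < b) (hab : 2 * b ≤ a) (hN : 0 < N)
    (hC₁ : 0 ≤ C₁) (hp : 0 ≤ p) (hθ : 0 ≤ θ)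
    (hsmall : p + κ * (8 * (b - 1) * C₁ + θ * C₂) < κ⁻¹ * (2 * g)) (hD : 0 < D)
    (hu : Continuous u) (hui : ∀ x, Integrable (secondDiff u x) ν)
    (hM : ∀ x : E, ‖x‖ < r 0 → -(D * p * N) ≤ ∫ h, pucci κ (secondDiff u x h) ∂ν)
    (n : ℕ) (hc : ∀ y, u y - c ≤ D * (b ^ n)⁻¹ * (1 + growthExcess b r n y)) (S : Set E)
    (hS : MeasurableSet S) (hSu : ∀ y ∈ S, u y ≤ c)
    (hSg : ∀ x : E, ‖x‖ ≤ 2 * r (n + 1) →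
      g * (a ^ n * N) ≤ ν.real ((x + ·) ⁻¹' (S ∩ {y | 4 * r (n + 1) ≤ ‖y‖})))
    (y : E) (hy : ‖y‖ ≤ r (n + 1)) : u y - c ≤ D * (b ^ n)⁻¹ * (1 - θ) := by
  have hbn : 0 < b ^ n := by positivity
  have hm : 0 < b ^ n / D := by positivity
  have hDm : D * (b ^ n)⁻¹ * (b ^ n / D) = 1 := by field_simp
  have hDm' : b ^ n / D * (D * (b ^ n)⁻¹) = 1 := by rw [mul_comm, hDm]
  have hap : 0 < a ^ n * N := by
    have : 0 < a := by linarith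
    positivity
  have hsd : ∀ x h, secondDiff (fun y => b ^ n / D * (u y - c)) x h
      = b ^ n / D * secondDiff u x h := by
    intro x h; unfold secondDiff; ring
  have hle : ∀ x : E, ‖x‖ ≤ 2 * r (n + 1) → ‖x‖ ≤ r n / 2 := fun x hx =>
    hx.trans (H.two_mul_le n)
  have key := le_one_sub_of_subsolution (ν := ν) (κ := κ) (ρ' := r (n + 1))
    (p := p * (a ^ n * N)) (e := 4 * (b - 1) * C₁ * (a ^ n * N)) (q := C₂ * (a ^ n * N))
    (g := g * (a ^ n * N)) (θ := θ) (v := fun y => b ^ n / D * (u y - c))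
    (Ex := growthExcess b r n) (A := S ∩ {y | 4 * r (n + 1) ≤ ‖y‖}) hκ (H.pos _)
    (by fun_prop) (growthExcess_nonneg hb.le r n)
    (fun y => by
      have := mul_le_mul_of_nonneg_left (hc y) hm.le
      rwa [← mul_assoc, hDm', one_mul] at this)
    (fun x hx => (H.growthExcess_integral hb.le hab hN.le hC₁ n x (hle x hx)).1)
    (fun x hx => (H.growthExcess_integral hb.le hab hN.le hC₁ n x (hle x hx)).2)
    (hS.inter (measurableSet_le measurable_const measurable_norm))
    (fun y hy => hy.2)
    (fun y hy => mul_nonpos_of_nonneg_of_nonpos hm.le (by linarith [hSu y hy.1]))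
    (fun x hx => measure_ne_top_of_subset
      ((Set.preimage_mono Set.inter_subset_right).trans
        (preimage_tail_subset (t := 2 * r (n + 1)) (by linarith)))
      (H.tail_ne_top _ (by linarith [H.pos (n + 1)])))
    hSg (H.integrable n) (H.integral_le n)
    (fun x _ => by
      simp only [hsd, pucci_mul hm.le]
      exact (integrable_pucci hκ (hui x)).const_mul _)
    (fun x hx => by
      simp only [hsd, pucci_mul hm.le]
      rw [integral_const_mul]
      have h1 : ‖x‖ < r 0 := (hle x hx).trans_lt
        (by linarith [H.antitone (Nat.zero_le n), H.pos n])
      have h2 := mul_le_mul_of_nonneg_left (hM x h1) hm.le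
      refine le_trans ?_ h2
      -- Normalization amplifies the right-hand side by b^n only, whereas the jump rates grow like
      -- a^n, so the error never dominates.
      have h3 : b ^ n ≤ a ^ n := pow_le_pow_left₀ (by linarith) (by linarith) n
      have h4 : b ^ n / D * -(D * p * N) = -(p * (b ^ n * N)) := by field_simp
      rw [h4]
      have := mul_le_mul_of_nonneg_left (mul_le_mul_of_nonneg_right h3 hN.le) hp
      linarith)
    hθ
    (by
      have := mul_lt_mul_of_pos_right hsmall hap
      linarith)
    y hy
  have h5 := mul_le_mul_of_nonneg_left key (by positivity : 0 ≤ D * (b ^ n)⁻¹)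
  rwa [← mul_assoc, hDm, one_mul] at h5

/-- Oscillation decay along a sequence of scales. -/
theorem IsScaleSequence.oscillation_decay (H : IsScaleSequence ν r a N C₁ C₂ g)
    {κ b p θ D : ℝ} {u : E → ℝ} (hκ : 1 ≤ κ) (hb : 1 < b) (hab : 2 * b ≤ a) (hN : 0 < N)
    (hC₁ : 0 ≤ C₁) (hp : 0 ≤ p) (hθ : 2 * (1 - b⁻¹) ≤ θ)
    (hsmall : p + κ * (8 * (b - 1) * C₁ + θ * C₂) < κ⁻¹ * (2 * g)) (hD : 0 < D)
    (hu : Continuous u) (hui : ∀ x, Integrable (secondDiff u x) ν) (huD : ∀ y, |u y| ≤ D)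
    (hM : ∀ x : E, ‖x‖ < r 0 → -(D * p * N) ≤ ∫ h, pucci κ (secondDiff u x h) ∂ν)
    (hM' : ∀ x : E, ‖x‖ < r 0 → -(D * p * N) ≤ ∫ h, pucci κ (-secondDiff u x h) ∂ν)
    (n : ℕ) : ∃ c, ∀ y, |u y - c| ≤ D * (b ^ n)⁻¹ * (1 + growthExcess b r n y) := by
  have hθ0 : 0 ≤ θ := by
    have : b⁻¹ ≤ 1 := inv_le_one_of_one_le₀ hb.le
    linarith
  induction n with
  | zero => exact ⟨0, fun y => by simpa [growthExcess] using huD y⟩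
  | succ n ih =>
    obtain ⟨c, hc⟩ := ih
    have hb0 : 0 < b := by linarith
    have hm : 0 < D * (b ^ n)⁻¹ := by positivity
    set m := D * (b ^ n)⁻¹ with hmdef
    have hm1 : D * (b ^ (n + 1))⁻¹ = m * b⁻¹ := by
      rw [hmdef, pow_succ, mul_inv]; ring
    have hbb : b⁻¹ * b = 1 := inv_mul_cancel₀ hb0.ne'
    -- Outside the new ball the bound deteriorates only through the shift of the centre by m(1 -
    -- b⁻¹). Rewritten in units of m b⁻¹, this explains the coefficient 2(b - 1) in `growthExcess`.
    have hsucc : ∀ y : E, m * b⁻¹ * (1 + growthExcess b r (n + 1) y) =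
        m * (1 + growthExcess b r n y) + m * (1 - b⁻¹) *
          (2 * {z : E | r (n + 1) ≤ ‖z‖}.indicator 1 y - 1) := by
      intro y
      simp only [growthExcess]
      linear_combination (m * growthExcess b r n y
        + 2 * m * {z : E | r (n + 1) ≤ ‖z‖}.indicator 1 y) * hbb
    have hpos : 0 < m * (1 - b⁻¹) := mul_pos hm (by
      have : b⁻¹ < 1 := inv_lt_one_of_one_lt₀ hb
      linarith)
    have hin : ∀ y : E, ‖y‖ < r (n + 1) → growthExcess b r n y = 0 := fun y hy =>
      growthExcess_eq_zero b H.antitone n (hy.trans_le (H.antitone n.le_succ))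
    have hSm : MeasurableSet {y | u y ≤ c} := measurableSet_le hu.measurable measurable_const
    have hθm := mul_le_mul_of_nonneg_left hθ hm.le
    rcases H.half_mass n {y | u y ≤ c} hSm with hS | hS
    · have key := H.one_sided_step hκ hb hab hN hC₁ hp hθ0 hsmall hD hu hui hM n (c := c)
        (fun y => (le_abs_self _).trans (hc y)) _ hSm (fun y hy => hy) hS
      -- On the new ball u - c lies between -m and m(1 - θ). Since θ ≥ 2(1 - b⁻¹), this range fits
      -- in an interval of half-width m b⁻¹ about the shifted centre.
      refine ⟨c - m * (1 - b⁻¹), fun y => ?_⟩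
      rw [hm1, hsucc]
      have h1 := abs_le.1 (hc y)
      by_cases hy : r (n + 1) ≤ ‖y‖
      · rw [Set.indicator_of_mem (show y ∈ {z : E | r (n + 1) ≤ ‖z‖} from hy), Pi.one_apply]
        exact abs_le.2 ⟨by linarith, by linarith⟩
      · have h2 := key y (not_le.1 hy).le
        rw [hin y (not_le.1 hy)] at h1 ⊢
        rw [Set.indicator_of_notMem (show y ∉ {z : E | r (n + 1) ≤ ‖z‖} from hy)]
        exact abs_le.2 ⟨by linarith, by linarith⟩
    · have hneg : ∀ x : E, secondDiff (fun y => -u y) x = fun h => -secondDiff u x h := by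
        intro x; ext h; unfold secondDiff; ring
      have key := H.one_sided_step (u := fun y => -u y) (c := -c) hκ hb hab hN hC₁ hp hθ0 hsmall
        hD hu.neg (fun x => by rw [hneg]; exact (hui x).neg)
        (fun x hx => by rw [hneg]; exact hM' x hx) n
        (fun y => by
          have := (neg_le_abs _).trans (hc y)
          linarith) _ hSm.compl
        (fun y hy => by
          have : c < u y := not_le.1 hy
          linarith) hS
      refine ⟨c + m * (1 - b⁻¹), fun y => ?_⟩
      rw [hm1, hsucc]
      have h1 := abs_le.1 (hc y)
      by_cases hy : r (n + 1) ≤ ‖y‖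
      · rw [Set.indicator_of_mem (show y ∈ {z : E | r (n + 1) ≤ ‖z‖} from hy), Pi.one_apply]
        exact abs_le.2 ⟨by linarith, by linarith⟩
      · have h2 := key y (not_le.1 hy).le
        rw [hin y (not_le.1 hy)] at h1 ⊢
        rw [Set.indicator_of_notMem (show y ∉ {z : E | r (n + 1) ≤ ‖z‖} from hy)]
        exact abs_le.2 ⟨by linarith, by linarith⟩

end Iteration

/-! ### One-dimensional estimates for ℓ and L. -/

section Scale

/-- The weight `ℓ(s) / s`, extended by zero outside of `(0, R₀)`. -/
noncomputable def scaleWeight (R₀ : ℝ≥0∞) (ell : ℝ → ℝ) (s : ℝ) : ℝ :=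
  (scaleInterval R₀).indicator ell s / s

variable {d : ℕ} {R₀ : ℝ≥0∞} {ell : ℝ → ℝ} {cL cU γ : ℝ}

theorem measurableSet_scaleInterval (R₀ : ℝ≥0∞) : MeasurableSet (scaleInterval R₀) :=
  (measurableSet_lt measurable_const measurable_id).inter
    (measurableSet_lt ENNReal.measurable_ofReal measurable_const)

theorem mem_scaleInterval_of_le {s t : ℝ} (hs : 0 < s) (hst : s ≤ t)
    (ht : t ∈ scaleInterval R₀) : s ∈ scaleInterval R₀ :=
  ⟨hs, (ENNReal.ofReal_le_ofReal hst).trans_lt ht.2⟩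

theorem mem_scaleInterval_of_lt {s t : ℝ} (hs : 0 < s) (hst : s < t)
    (ht : ENNReal.ofReal t ≤ R₀) : s ∈ scaleInterval R₀ :=
  ⟨hs, ((ENNReal.ofReal_lt_ofReal_iff (hs.trans hst)).2 hst).trans_le ht⟩

theorem tailInterval_eq {r : ℝ} (hr : 0 ≤ r) :
    tailInterval R₀ r = scaleInterval R₀ ∩ Set.Ioi r := by
  ext s
  simp only [tailInterval, scaleInterval, Set.mem_ofPred_eq, Set.mem_inter_iff, Set.mem_Ioi]
  exact ⟨fun h => ⟨⟨hr.trans_lt h.1, h.2⟩, h.1⟩, fun h => ⟨h.2, h.1.2⟩⟩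

theorem scaleWeight_eq_indicator :
    scaleWeight R₀ ell = (scaleInterval R₀).indicator (fun s => ell s / s) := by
  ext s
  by_cases hs : s ∈ scaleInterval R₀ <;> simp [scaleWeight, hs]

theorem scaleL_eq {r : ℝ} (hr : 0 ≤ r) :
    scaleL R₀ ell r = ∫ s in Set.Ioi r, scaleWeight R₀ ell s := by
  rw [scaleL, tailInterval_eq hr, scaleWeight_eq_indicator,
    setIntegral_indicator (measurableSet_scaleInterval R₀), Set.inter_comm]

namespace IsScale

theorem measurable_indicator (h : IsScale d R₀ ell cL cU γ) :
    Measurable ((scaleInterval R₀).indicator ell) := by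
  refine measurable_of_restrict_of_restrict_compl (measurableSet_scaleInterval R₀) ?_ ?_
  · convert h.measurable using 1
    ext s
    exact Set.indicator_of_mem s.2 _
  · convert measurable_const (a := (0 : ℝ)) using 1
    ext s
    exact Set.indicator_of_notMem s.2 _

theorem indicator_nonneg (h : IsScale d R₀ ell cL cU γ) (s : ℝ) :
    0 ≤ (scaleInterval R₀).indicator ell s :=
  Set.indicator_nonneg (fun t ht => (h.pos t ht).le) s

theorem measurable_weight (h : IsScale d R₀ ell cL cU γ) : Measurable (scaleWeight R₀ ell) :=
  h.measurable_indicator.div measurable_id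

theorem weight_nonneg (h : IsScale d R₀ ell cL cU γ) {s : ℝ} (hs : 0 ≤ s) :
    0 ≤ scaleWeight R₀ ell s :=
  div_nonneg (h.indicator_nonneg s) hs

theorem lintegral_weight_Ioi {r : ℝ} (hr : 0 ≤ r) :
    ∫⁻ s in Set.Ioi r, ENNReal.ofReal (scaleWeight R₀ ell s)
      = ∫⁻ s in tailInterval R₀ r, ENNReal.ofReal (ell s / s) := by
  rw [tailInterval_eq hr, ← setLIntegral_indicator (measurableSet_scaleInterval R₀)]
  refine lintegral_congr fun s => ?_
  by_cases hs : s ∈ scaleInterval R₀ <;> simp [scaleWeight, hs]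

theorem integrableOn_weight (h : IsScale d R₀ ell cL cU γ) {r : ℝ} (hr : 0 < r) :
    IntegrableOn (scaleWeight R₀ ell) (Set.Ioi r) := by
  refine ⟨h.measurable_weight.aestronglyMeasurable, ?_⟩
  rw [hasFiniteIntegral_iff_ofReal ((ae_restrict_iff' measurableSet_Ioi).2
    (Filter.Eventually.of_forall fun s hs => h.weight_nonneg (hr.trans hs).le)),
    lintegral_weight_Ioi hr.le]
  by_cases hrI : r ∈ scaleInterval R₀
  · exact h.lintegral_tail_lt_top r hrI
  · have : tailInterval R₀ r = ∅ := by
      rw [Set.eq_empty_iff_forall_notMem]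
      rintro s ⟨hs1, hs2⟩
      exact hrI (mem_scaleInterval_of_le hr hs1.le ⟨hr.trans hs1, hs2⟩)
    simp [this]

theorem scaleL_sub (h : IsScale d R₀ ell cL cU γ) {s t : ℝ} (hs : 0 < s) (hst : s ≤ t) :
    scaleL R₀ ell s = scaleL R₀ ell t + ∫ y in s..t, scaleWeight R₀ ell y := by
  rw [scaleL_eq hs.le, scaleL_eq (hs.le.trans hst),
    ← intervalIntegral.integral_Ioi_sub_Ioi (h.integrableOn_weight hs) hst]
  ring

theorem scaleL_anti (h : IsScale d R₀ ell cL cU γ) {s t : ℝ} (hs : 0 < s) (hst : s ≤ t) :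
    scaleL R₀ ell t ≤ scaleL R₀ ell s := by
  rw [h.scaleL_sub hs hst]
  have := intervalIntegral.integral_nonneg (f := scaleWeight R₀ ell) (μ := volume) hst
    fun y hy => h.weight_nonneg (hs.le.trans hy.1)
  linarith

theorem ell_le_of_le (h : IsScale d R₀ ell cL cU γ) {s t : ℝ} (hs : 0 < s) (hst : s ≤ t)
    (ht : ENNReal.ofReal t < R₀) : ell s ≤ cL⁻¹ * (t / s) ^ γ * ell t := by
  have h1 : 1 ≤ t / s := (one_le_div hs).2 hst
  have h0 : 0 < t / s := by linarith
  have e : s * (t / s) = t := by field_simp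
  have h2 := h.lower_scaling s (t / s) hs h1 (by rwa [e])
  have hls : 0 < ell s := h.pos s (mem_scaleInterval_of_le hs hst ⟨hs.trans_le hst, ht⟩)
  rw [e, le_div_iff₀ hls, Real.rpow_neg h0.le] at h2
  have hp : 0 < (t / s) ^ γ := Real.rpow_pos_of_pos h0 _
  have hc := h.cL_pos
  calc ell s = cL⁻¹ * (t / s) ^ γ * (cL * ((t / s) ^ γ)⁻¹ * ell s) := by field_simp
    _ ≤ _ := mul_le_mul_of_nonneg_left h2 (by positivity)

theorem ell_le_of_le_two_mul (h : IsScale d R₀ ell cL cU γ) {s t : ℝ} (hs : 0 < s)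
    (hst : s ≤ t) (hts : t ≤ 2 * s) (ht : ENNReal.ofReal t < R₀) : ell s ≤ 4 / cL * ell t := by
  refine (h.ell_le_of_le hs hst ht).trans ?_
  have hlt : 0 < ell t := h.pos t ⟨hs.trans_le hst, ht⟩
  refine mul_le_mul_of_nonneg_right ?_ hlt.le
  have h1 : (t / s) ^ γ ≤ 4 := by
    calc (t / s) ^ γ ≤ 2 ^ γ := Real.rpow_le_rpow (div_nonneg (hs.le.trans hst) hs.le)
          ((div_le_iff₀ hs).2 hts) h.γ_pos.le
      _ ≤ (2 : ℝ) ^ (2 : ℝ) := Real.rpow_le_rpow_of_exponent_le (by norm_num) h.γ_lt_two.le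
      _ = 4 := by norm_num
  rw [div_eq_inv_mul 4 cL]
  exact mul_le_mul_of_nonneg_left h1 (inv_nonneg.2 h.cL_pos.le)

theorem weight_eq {s : ℝ} (hs : s ∈ scaleInterval R₀) : scaleWeight R₀ ell s = ell s / s := by
  rw [scaleWeight, Set.indicator_of_mem hs]

theorem scaleL_nonneg (h : IsScale d R₀ ell cL cU γ) {s : ℝ} (hs : 0 < s) :
    0 ≤ scaleL R₀ ell s := by
  rw [scaleL_eq hs.le]
  exact setIntegral_nonneg measurableSet_Ioi fun y hy => h.weight_nonneg (hs.trans hy).le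

/-- On (s, 2s) the function ℓ is at least (cL/4) ℓ(s), and ds/s gives this interval mass at least
1/2. The interval must fit below R₀. -/
theorem ell_le_scaleL (h : IsScale d R₀ ell cL cU γ) {s : ℝ} (hs : 0 < s)
    (h2 : ENNReal.ofReal (2 * s) ≤ R₀) : ell s ≤ 8 / cL * scaleL R₀ ell s := by
  have hc := h.cL_pos
  have hsI : s ∈ scaleInterval R₀ := mem_scaleInterval_of_lt hs (by linarith) h2
  have hls := h.pos s hsI
  have hm : ∀ y, s ≤ y → y < 2 * s → cL / 4 * ell s ≤ ell y := by
    intro y hy hy2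
    have := h.ell_le_of_le_two_mul hs hy hy2.le
      (mem_scaleInterval_of_lt (hs.trans_le hy) hy2 h2).2
    calc cL / 4 * ell s ≤ cL / 4 * (4 / cL * ell y) :=
          mul_le_mul_of_nonneg_left this (by positivity)
      _ = ell y := by field_simp
  have h3 : cL / 4 * ell s / 2 ≤ ∫ y in s..2 * s, scaleWeight R₀ ell y := by
    have hs2 : s ≤ 2 * s := by linarith
    have hi : IntervalIntegrable (scaleWeight R₀ ell) volume s (2 * s) := by
      rw [intervalIntegrable_iff_integrableOn_Ioc_of_le hs2]
      exact (h.integrableOn_weight hs).mono_set Set.Ioc_subset_Ioi_self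
    have := intervalIntegral.integral_mono_on_of_le_Ioo hs2
      (intervalIntegrable_const (c := cL / 4 * ell s / (2 * s))) hi fun y hy => by
        have hy0 : 0 < y := hs.trans hy.1
        rw [weight_eq (mem_scaleInterval_of_lt hy0 hy.2 h2)]
        have b1 := hm y hy.1.le hy.2
        exact div_le_div₀ (le_trans (by positivity) b1) b1 hy0 hy.2.le
    rw [intervalIntegral.integral_const, smul_eq_mul] at this
    calc cL / 4 * ell s / 2 = (2 * s - s) * (cL / 4 * ell s / (2 * s)) := by field_simp; ring
      _ ≤ _ := this
  have h4 := h.scaleL_sub hs (by linarith : s ≤ 2 * s)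
  have h5 := h.scaleL_nonneg (by linarith : 0 < 2 * s)
  calc ell s = 8 / cL * (cL / 4 * ell s / 2) := by field_simp; norm_num
    _ ≤ _ := mul_le_mul_of_nonneg_left (by linarith) (by positivity)

/-- The increment over (s, 2s) is at most (4/cL) ℓ(2s), and ℓ(2s) is in turn controlled by L(2s). -/
theorem scaleL_le_scaleL_two_mul (h : IsScale d R₀ ell cL cU γ) {s : ℝ} (hs : 0 < s)
    (h4 : ENNReal.ofReal (4 * s) ≤ R₀) :
    scaleL R₀ ell s ≤ (32 / cL ^ 2 + 1) * scaleL R₀ ell (2 * s) := by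
  have hc := h.cL_pos
  have hs2 : s ≤ 2 * s := by linarith
  have h2I : 2 * s ∈ scaleInterval R₀ :=
    mem_scaleInterval_of_lt (by linarith) (by linarith : 2 * s < 4 * s) h4
  have hl2 := h.pos _ h2I
  have hi : IntervalIntegrable (scaleWeight R₀ ell) volume s (2 * s) := by
    rw [intervalIntegrable_iff_integrableOn_Ioc_of_le hs2]
    exact (h.integrableOn_weight hs).mono_set Set.Ioc_subset_Ioi_self
  have := intervalIntegral.integral_mono_on_of_le_Ioo hs2 hi
    (intervalIntegrable_const (c := 4 / cL * ell (2 * s) / s)) fun y hy => by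
      have hy0 : 0 < y := hs.trans hy.1
      have hyI := mem_scaleInterval_of_le hy0 hy.2.le h2I
      rw [weight_eq hyI]
      exact div_le_div₀ (by positivity)
        (h.ell_le_of_le_two_mul hy0 hy.2.le (by linarith [hy.1]) h2I.2) hs hy.1.le
  rw [intervalIntegral.integral_const, smul_eq_mul] at this
  have e : (2 * s - s) * (4 / cL * ell (2 * s) / s) = 4 / cL * ell (2 * s) := by
    field_simp; ring
  have h6 := h.ell_le_scaleL (by linarith : 0 < 2 * s)
    (by rwa [show 2 * (2 * s) = 4 * s by ring])
  have h7 := mul_le_mul_of_nonneg_left h6 (by positivity : 0 ≤ 4 / cL)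
  have e2 : 4 / cL * (8 / cL * scaleL R₀ ell (2 * s))
      = 32 / cL ^ 2 * scaleL R₀ ell (2 * s) := by field_simp; ring
  rw [h.scaleL_sub hs hs2]
  linarith

theorem scaleL_pos (h : IsScale d R₀ ell cL cU γ) {s : ℝ} (hs : 0 < s)
    (h2 : ENNReal.ofReal (2 * s) ≤ R₀) : 0 < scaleL R₀ ell s := by
  have hsI : s ∈ scaleInterval R₀ := mem_scaleInterval_of_lt hs (by linarith) h2
  have h3 := (h.pos s hsI).trans_le (h.ell_le_scaleL hs h2)
  exact pos_of_mul_pos_right h3 (div_nonneg (by norm_num) h.cL_pos.le)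

/-- Half-lines starting at s₀/(n+1) exhaust (0,∞), so a bound on L would make the divergent integral
finite by monotone convergence. -/
theorem exists_scaleL_ge (h : IsScale d R₀ ell cL cU γ) (M : ℝ) {s₀ : ℝ} (hs₀ : 0 < s₀) :
    ∃ s, 0 < s ∧ s ≤ s₀ ∧ M ≤ scaleL R₀ ell s := by
  by_contra! hcon
  have hbd : ∀ n : ℕ, ∫⁻ s in Set.Ioi (s₀ / (n + 1)), ENNReal.ofReal (scaleWeight R₀ ell s)
      ≤ ENNReal.ofReal M := by
    intro n
    have hn : 0 < s₀ / (n + 1) := by positivity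
    rw [← ofReal_integral_eq_lintegral_ofReal (h.integrableOn_weight hn)
      ((ae_restrict_iff' measurableSet_Ioi).2
        (Filter.Eventually.of_forall fun s hs => h.weight_nonneg (hn.trans hs).le)),
      ← scaleL_eq hn.le]
    exact ENNReal.ofReal_le_ofReal (hcon _ hn (div_le_self hs₀.le (by simp))).le
  have hU : (⋃ n : ℕ, Set.Ioi (s₀ / ((n : ℝ) + 1))) = Set.Ioi (0 : ℝ) := by
    ext y
    simp only [Set.mem_iUnion, Set.mem_Ioi]
    constructor
    · rintro ⟨n, hn⟩
      exact lt_trans (by positivity) hn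
    · intro hy
      obtain ⟨n, hn⟩ := exists_nat_gt (s₀ / y)
      refine ⟨n, ?_⟩
      rw [div_lt_iff₀ hy] at hn
      rw [div_lt_iff₀ (by positivity)]
      nlinarith
  have hdir : Directed (· ⊆ ·) fun n : ℕ => Set.Ioi (s₀ / ((n : ℝ) + 1)) := by
    refine Monotone.directed_le (f := fun n : ℕ => Set.Ioi (s₀ / ((n : ℝ) + 1))) ?_
    intro m n hmn
    refine Set.Ioi_subset_Ioi ?_
    have : (m : ℝ) ≤ n := by exact_mod_cast hmn
    gcongr
  have h1 := setLIntegral_iUnion_of_directed (μ := volume)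
    (fun s => ENNReal.ofReal (scaleWeight R₀ ell s)) hdir
  rw [hU, lintegral_weight_Ioi le_rfl] at h1
  have h2 : tailInterval R₀ 0 = scaleInterval R₀ := rfl
  rw [h2, h.lintegral_eq_top] at h1
  have h3 := h1.le.trans (iSup_le hbd)
  exact absurd h3 (by simp)

/-- L is continuous and unbounded near 0, so the intermediate value theorem provides radii with
prescribed L. -/
theorem exists_scaleL_eq (h : IsScale d R₀ ell cL cU γ) {s₀ t : ℝ} (hs₀ : 0 < s₀)
    (ht : scaleL R₀ ell s₀ ≤ t) : ∃ s, 0 < s ∧ s ≤ s₀ ∧ scaleL R₀ ell s = t := by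
  obtain ⟨s₁, h1, h2, h3⟩ := h.exists_scaleL_ge t hs₀
  have hi : IntegrableOn (scaleWeight R₀ ell) (Set.uIcc s₁ s₀) := by
    rw [Set.uIcc_of_le h2]
    exact (h.integrableOn_weight (half_pos h1)).mono_set fun y hy =>
      lt_of_lt_of_le (half_lt_self h1) hy.1
  have hc : ContinuousOn (scaleL R₀ ell) (Set.Icc s₁ s₀) := by
    have := (intervalIntegral.continuousOn_primitive_interval (μ := volume) hi)
    rw [Set.uIcc_of_le h2] at this
    refine (continuousOn_const (c := scaleL R₀ ell s₁)).sub this |>.congr fun y hy => ?_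
    have := h.scaleL_sub h1 hy.1
    simp only [Pi.sub_apply]
    linarith
  obtain ⟨s, hs, hst⟩ := intermediate_value_Icc' h2 hc ⟨ht, h3⟩
  exact ⟨s, h1.trans_le hs.1, hs.2, hst⟩

/-- Lower scaling dominates the integrand by a multiple of y^{1-γ}, which is integrable at 0
precisely because γ < 2. -/
theorem second_moment_weight (h : IsScale d R₀ ell cL cU γ) {s : ℝ}
    (hs : s ∈ scaleInterval R₀) :
    IntegrableOn (fun y => y ^ 2 / s ^ 2 * scaleWeight R₀ ell y) (Set.Ioo 0 s) ∧
      ∫ y in Set.Ioo 0 s, y ^ 2 / s ^ 2 * scaleWeight R₀ ell y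
        ≤ (cL * (2 - γ))⁻¹ * ell s := by
  have hs0 : 0 < s := hs.1
  have hc := h.cL_pos
  have hγ := h.γ_lt_two
  have hls := h.pos s hs
  have hexp : -1 < 1 - γ := by linarith
  have hint : IntegrableOn (fun y : ℝ => cL⁻¹ * ell s * (s ^ γ / s ^ 2) * y ^ (1 - γ))
      (Set.Ioo 0 s) :=
    ((intervalIntegral.integrableOn_Ioo_rpow_iff hs0).2 hexp).const_mul _
  have hpt : ∀ y ∈ Set.Ioo 0 s, y ^ 2 / s ^ 2 * scaleWeight R₀ ell y
      ≤ cL⁻¹ * ell s * (s ^ γ / s ^ 2) * y ^ (1 - γ) := by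
    intro y hy
    have hy0 : 0 < y := hy.1
    have h1 := h.ell_le_of_le hy0 hy.2.le hs.2
    rw [weight_eq (mem_scaleInterval_of_le hy0 hy.2.le hs)]
    have h2 : y ^ (1 - γ) = y / y ^ γ := by
      rw [Real.rpow_sub hy0, Real.rpow_one]
    rw [Real.div_rpow hs0.le hy0.le] at h1
    have hp : 0 < y ^ γ := Real.rpow_pos_of_pos hy0 _
    calc y ^ 2 / s ^ 2 * (ell y / y) = y / s ^ 2 * ell y := by field_simp
      _ ≤ y / s ^ 2 * (cL⁻¹ * (s ^ γ / y ^ γ) * ell s) :=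
          mul_le_mul_of_nonneg_left h1 (by positivity)
      _ = _ := by rw [h2]; field_simp
  have hnn : ∀ y ∈ Set.Ioo 0 s, 0 ≤ y ^ 2 / s ^ 2 * scaleWeight R₀ ell y := fun y hy =>
    mul_nonneg (by positivity) (h.weight_nonneg hy.1.le)
  have hi : IntegrableOn (fun y => y ^ 2 / s ^ 2 * scaleWeight R₀ ell y) (Set.Ioo 0 s) := by
    refine Integrable.mono' hint ?_ ?_
    · exact (((measurable_id.pow_const 2).div_const _).mul
        h.measurable_weight).aestronglyMeasurable
    · refine (ae_restrict_iff' measurableSet_Ioo).2 (Filter.Eventually.of_forall fun y hy => ?_)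
      rw [Real.norm_eq_abs, abs_of_nonneg (hnn y hy)]
      exact hpt y hy
  refine ⟨hi, (setIntegral_mono_on hi hint measurableSet_Ioo hpt).trans_eq ?_⟩
  rw [integral_const_mul, ← integral_Ioc_eq_integral_Ioo,
    ← intervalIntegral.integral_of_le hs0.le, integral_rpow (Or.inl hexp)]
  have e1 : 1 - γ + 1 = 2 - γ := by ring
  have h2 : s ^ (2 - γ) = s ^ 2 / s ^ γ := by
    rw [Real.rpow_sub hs0, Real.rpow_two]
  have hg : 2 - γ ≠ 0 := by linarith
  rw [e1, Real.zero_rpow hg, h2]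
  have hp : s ^ γ ≠ 0 := (Real.rpow_pos_of_pos hs0 _).ne'
  field_simp
  ring

end IsScale

end Scale

/-! ### The reference jump measure and its scale sequence. -/

section JumpMeasure

/-- The radial profile `s^{-d} ℓ(s)` on `(0, R₀)`, extended by zero. -/
noncomputable def jumpProfile (d : ℕ) (R₀ : ℝ≥0∞) (ell : ℝ → ℝ) (s : ℝ) : ℝ :=
  (scaleInterval R₀).indicator ell s / s ^ d

/-- The measure `|h|^{-d} ℓ(|h|) dh` on `B_{R₀}`. -/
noncomputable def jumpMeasure (d : ℕ) (R₀ : ℝ≥0∞) (ell : ℝ → ℝ) :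
    Measure (EuclideanSpace ℝ (Fin d)) :=
  volume.withDensity fun h => ENNReal.ofReal (jumpProfile d R₀ ell ‖h‖)

/-- The surface area of the unit sphere. -/
noncomputable def sphereArea (d : ℕ) : ℝ :=
  d * (volume : Measure (EuclideanSpace ℝ (Fin d))).real (Metric.ball 0 1)

theorem sphereArea_pos {d : ℕ} (hd : 1 ≤ d) : 0 < sphereArea d := by
  refine mul_pos (by exact_mod_cast hd) ?_
  exact ENNReal.toReal_pos (Metric.measure_ball_pos volume 0 one_pos).ne'
    measure_ball_lt_top.ne

variable {d : ℕ} {R₀ : ℝ≥0∞} {ell : ℝ → ℝ} {cL cU γ : ℝ}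

instance isNegInvariant_jumpMeasure (d : ℕ) (R₀ : ℝ≥0∞) (ell : ℝ → ℝ) :
    (jumpMeasure d R₀ ell).IsNegInvariant := by
  refine ⟨Measure.ext fun A hA => ?_⟩
  rw [Measure.neg, Measure.map_apply measurable_neg hA, jumpMeasure, withDensity_apply _ hA,
    withDensity_apply _ (measurable_neg hA), ← lintegral_indicator hA,
    ← lintegral_indicator (measurable_neg hA), ← lintegral_neg_eq_self]
  refine lintegral_congr fun z => ?_
  by_cases hz : z ∈ A <;> simp [hz]

namespace IsScale

theorem jumpProfile_nonneg (h : IsScale d R₀ ell cL cU γ) {s : ℝ} (hs : 0 ≤ s) :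
    0 ≤ jumpProfile d R₀ ell s :=
  div_nonneg (h.indicator_nonneg s) (by positivity)

theorem measurable_jumpProfile_norm (h : IsScale d R₀ ell cL cU γ) :
    Measurable fun x : EuclideanSpace ℝ (Fin d) => jumpProfile d R₀ ell ‖x‖ :=
  (h.measurable_indicator.div (measurable_id.pow_const d)).comp measurable_norm

theorem integrable_jumpMeasure_iff (h : IsScale d R₀ ell cL cU γ)
    {f : EuclideanSpace ℝ (Fin d) → ℝ} :
    Integrable f (jumpMeasure d R₀ ell) ↔
      Integrable (fun x => jumpProfile d R₀ ell ‖x‖ * f x) volume := by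
  rw [jumpMeasure, integrable_withDensity_iff_integrable_smul'
    h.measurable_jumpProfile_norm.ennreal_ofReal
    (Filter.Eventually.of_forall fun _ => ENNReal.ofReal_lt_top)]
  simp only [ENNReal.toReal_ofReal (h.jumpProfile_nonneg (norm_nonneg _)), smul_eq_mul]

theorem integral_jumpMeasure (h : IsScale d R₀ ell cL cU γ)
    (f : EuclideanSpace ℝ (Fin d) → ℝ) :
    ∫ x, f x ∂(jumpMeasure d R₀ ell) = ∫ x, jumpProfile d R₀ ell ‖x‖ * f x := by
  rw [jumpMeasure, integral_withDensity_eq_integral_toReal_smul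
    h.measurable_jumpProfile_norm.ennreal_ofReal
    (Filter.Eventually.of_forall fun _ => ENNReal.ofReal_lt_top)]
  simp only [ENNReal.toReal_ofReal (h.jumpProfile_nonneg (norm_nonneg _)), smul_eq_mul]

theorem pow_mul_jumpProfile (hd : 1 ≤ d) {y : ℝ} (hy : 0 < y) (g : ℝ → ℝ) :
    y ^ (d - 1) * (jumpProfile d R₀ ell y * g y) = g y * scaleWeight R₀ ell y := by
  have e : y ^ d = y ^ (d - 1) * y := by rw [← pow_succ, Nat.sub_add_cancel hd]
  unfold jumpProfile scaleWeight
  rw [e]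
  field_simp

theorem integrable_radial_iff (h : IsScale d R₀ ell cL cU γ) (hd : 1 ≤ d) (g : ℝ → ℝ) :
    Integrable (fun x : EuclideanSpace ℝ (Fin d) => g ‖x‖) (jumpMeasure d R₀ ell) ↔
      IntegrableOn (fun y => g y * scaleWeight R₀ ell y) (Set.Ioi 0) := by
  have : Nonempty (Fin d) := ⟨⟨0, hd⟩⟩
  rw [h.integrable_jumpMeasure_iff,
    integrable_fun_norm_addHaar volume (f := fun y => jumpProfile d R₀ ell y * g y),
    finrank_euclideanSpace_fin]
  exact integrableOn_congr_fun (fun y hy => pow_mul_jumpProfile hd hy g) measurableSet_Ioi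

theorem integral_radial (h : IsScale d R₀ ell cL cU γ) (hd : 1 ≤ d) (g : ℝ → ℝ) :
    ∫ x : EuclideanSpace ℝ (Fin d), g ‖x‖ ∂(jumpMeasure d R₀ ell) =
      sphereArea d * ∫ y in Set.Ioi 0, g y * scaleWeight R₀ ell y := by
  have : Nonempty (Fin d) := ⟨⟨0, hd⟩⟩
  rw [h.integral_jumpMeasure,
    integral_fun_norm_addHaar volume (fun y => jumpProfile d R₀ ell y * g y),
    finrank_euclideanSpace_fin, sphereArea, nsmul_eq_mul, smul_eq_mul, mul_assoc]
  congr 2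
  exact setIntegral_congr_fun measurableSet_Ioi fun y hy => pow_mul_jumpProfile hd hy g

theorem tail_jumpMeasure (h : IsScale d R₀ ell cL cU γ) (hd : 1 ≤ d) {s : ℝ} (hs : 0 < s) :
    jumpMeasure d R₀ ell {x | s ≤ ‖x‖} ≠ ⊤ ∧
      (jumpMeasure d R₀ ell).real {x | s ≤ ‖x‖} = sphereArea d * scaleL R₀ ell s := by
  have hm : MeasurableSet {x : EuclideanSpace ℝ (Fin d) | s ≤ ‖x‖} :=
    measurableSet_le measurable_const measurable_norm
  have e1 : ({x : EuclideanSpace ℝ (Fin d) | s ≤ ‖x‖}.indicator (1 : EuclideanSpace ℝ (Fin d) → ℝ))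
      = fun x => (Set.Ici s).indicator (1 : ℝ → ℝ) ‖x‖ := rfl
  have e2 : (fun y => (Set.Ici s).indicator (1 : ℝ → ℝ) y * scaleWeight R₀ ell y)
      = (Set.Ici s).indicator (scaleWeight R₀ ell) := by
    ext y
    by_cases hy : y ∈ Set.Ici s <;> simp [hy]
  have e3 : Set.Ioi (0 : ℝ) ∩ Set.Ici s = Set.Ici s :=
    Set.inter_eq_right.2 fun y hy => hs.trans_le hy
  have hi : IntegrableOn (scaleWeight R₀ ell) (Set.Ici s) :=
    (h.integrableOn_weight (half_pos hs)).mono_set fun y hy => (half_lt_self hs).trans_le hy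
  constructor
  · have : Integrable ({x : EuclideanSpace ℝ (Fin d) | s ≤ ‖x‖}.indicator
        (1 : EuclideanSpace ℝ (Fin d) → ℝ)) (jumpMeasure d R₀ ell) := by
      rw [e1, h.integrable_radial_iff hd, e2, IntegrableOn,
        integrable_indicator_iff measurableSet_Ici, IntegrableOn,
        Measure.restrict_restrict measurableSet_Ici, Set.inter_comm, e3]
      exact hi
    rw [integrable_indicator_iff hm] at this
    exact ((integrableOn_const_iff (C := (1 : ℝ))).1 this).resolve_left (by simp) |>.ne
  · rw [← integral_indicator_one hm, e1, h.integral_radial hd, e2,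
      setIntegral_indicator measurableSet_Ici, e3, scaleL_eq hs.le,
      integral_Ici_eq_integral_Ioi]

theorem second_moment_jumpMeasure (h : IsScale d R₀ ell cL cU γ) (hd : 1 ≤ d) {s : ℝ}
    (hs : 0 < s) (h2 : ENNReal.ofReal (2 * s) ≤ R₀) :
    Integrable (fun x : EuclideanSpace ℝ (Fin d) => min 4 (‖x‖ ^ 2 / s ^ 2))
        (jumpMeasure d R₀ ell) ∧
      ∫ x : EuclideanSpace ℝ (Fin d), min 4 (‖x‖ ^ 2 / s ^ 2) ∂(jumpMeasure d R₀ ell)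
        ≤ sphereArea d * ((cL * (2 - γ))⁻¹ * (8 / cL) + 4) * scaleL R₀ ell s := by
  have hsI : s ∈ scaleInterval R₀ := mem_scaleInterval_of_lt hs (by linarith) h2
  have hc := h.cL_pos
  have hγ : 0 < 2 - γ := by linarith [h.γ_lt_two]
  obtain ⟨i1, i2⟩ := h.second_moment_weight hsI
  have hmeas : Measurable fun y : ℝ => min 4 (y ^ 2 / s ^ 2) * scaleWeight R₀ ell y :=
    (measurable_const.min ((measurable_id.pow_const 2).div_const _)).mul h.measurable_weight
  have hnn : ∀ y : ℝ, 0 < y → 0 ≤ min 4 (y ^ 2 / s ^ 2) * scaleWeight R₀ ell y := fun y hy =>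
    mul_nonneg (le_min (by norm_num) (by positivity)) (h.weight_nonneg hy.le)
  have p1 : ∀ y ∈ Set.Ioo 0 s, min 4 (y ^ 2 / s ^ 2) * scaleWeight R₀ ell y
      ≤ y ^ 2 / s ^ 2 * scaleWeight R₀ ell y := fun y hy =>
    mul_le_mul_of_nonneg_right (min_le_right _ _) (h.weight_nonneg hy.1.le)
  have p2 : ∀ y ∈ Set.Ici s, min 4 (y ^ 2 / s ^ 2) * scaleWeight R₀ ell y
      ≤ 4 * scaleWeight R₀ ell y := fun y hy =>
    mul_le_mul_of_nonneg_right (min_le_left _ _) (h.weight_nonneg (hs.le.trans hy))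
  have i3 : IntegrableOn (fun y => 4 * scaleWeight R₀ ell y) (Set.Ici s) :=
    Integrable.const_mul ((h.integrableOn_weight (half_pos hs)).mono_set
      fun y hy => (half_lt_self hs).trans_le hy) 4
  have j1 : IntegrableOn (fun y => min 4 (y ^ 2 / s ^ 2) * scaleWeight R₀ ell y)
      (Set.Ioo 0 s) := by
    refine Integrable.mono' i1 hmeas.aestronglyMeasurable
      ((ae_restrict_iff' measurableSet_Ioo).2 (Filter.Eventually.of_forall fun y hy => ?_))
    rw [Real.norm_eq_abs, abs_of_nonneg (hnn y hy.1)]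
    exact p1 y hy
  have j2 : IntegrableOn (fun y => min 4 (y ^ 2 / s ^ 2) * scaleWeight R₀ ell y)
      (Set.Ici s) := by
    refine Integrable.mono' i3 hmeas.aestronglyMeasurable
      ((ae_restrict_iff' measurableSet_Ici).2 (Filter.Eventually.of_forall fun y hy => ?_))
    rw [Real.norm_eq_abs, abs_of_nonneg (hnn y (hs.trans_le hy))]
    exact p2 y hy
  have hU : Set.Ioo 0 s ∪ Set.Ici s = Set.Ioi (0 : ℝ) := by
    ext y
    simp only [Set.mem_union, Set.mem_Ioo, Set.mem_Ici, Set.mem_Ioi]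
    constructor
    · rintro (hy | hy)
      · exact hy.1
      · exact hs.trans_le hy
    · intro hy
      rcases lt_or_ge y s with hys | hys
      · exact Or.inl ⟨hy, hys⟩
      · exact Or.inr hys
  have hdisj : Disjoint (Set.Ioo 0 s) (Set.Ici s) :=
    Set.disjoint_left.2 fun y hy hy2 => absurd hy.2 (not_lt.2 hy2)
  constructor
  · rw [h.integrable_radial_iff hd (fun y => min 4 (y ^ 2 / s ^ 2)), ← hU]
    exact j1.union j2
  · rw [h.integral_radial hd (fun y => min 4 (y ^ 2 / s ^ 2)), ← hU,
      setIntegral_union hdisj measurableSet_Ici j1 j2, mul_assoc]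
    refine mul_le_mul_of_nonneg_left ?_ (sphereArea_pos hd).le
    have k1 := (setIntegral_mono_on j1 i1 measurableSet_Ioo p1).trans i2
    have k2 := setIntegral_mono_on j2 i3 measurableSet_Ici p2
    have k0 : ∫ y in Set.Ici s, scaleWeight R₀ ell y = scaleL R₀ ell s := by
      rw [integral_Ici_eq_integral_Ioi, ← scaleL_eq hs.le]
    rw [integral_const_mul, k0] at k2
    have k3 := mul_le_mul_of_nonneg_left (h.ell_le_scaleL hs h2)
      (by positivity : 0 ≤ (cL * (2 - γ))⁻¹)
    linarith

/-- For t ≤ s, upper scaling with exponent d says that s^{-d} ℓ(s) is almost decreasing. For s ≤ t ≤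
2s, lower scaling loses at most cL/4 and the power loses 2^d. -/
theorem jumpProfile_comparable (h : IsScale d R₀ ell cL cU γ) {s t : ℝ} (hs : 0 < s)
    (h1 : s / 2 ≤ t) (h2 : t ≤ 2 * s) (hs2 : ENNReal.ofReal t < R₀)
    (hsR : ENNReal.ofReal s < R₀) :
    cU⁻¹ * (cL / 4) / 2 ^ d * jumpProfile d R₀ ell s ≤ jumpProfile d R₀ ell t := by
  have ht : 0 < t := by linarith
  have hc := h.cL_pos
  have hc1 := h.cL_lt_one
  have hcU := h.one_le_cU
  have hcU0 : 0 < cU := by linarith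
  have hls := h.pos s ⟨hs, hsR⟩
  have hlt := h.pos t ⟨ht, hs2⟩
  rw [jumpProfile, jumpProfile, Set.indicator_of_mem (show s ∈ scaleInterval R₀ from ⟨hs, hsR⟩),
    Set.indicator_of_mem (show t ∈ scaleInterval R₀ from ⟨ht, hs2⟩)]
  rcases le_total t s with hts | hst
  · have k1 := h.upper_scaling t (s / t) ht ((one_le_div ht).2 hts)
    have e : t * (s / t) = s := by field_simp
    rw [e] at k1
    have k2 := k1 hsR
    rw [div_le_iff₀ hlt, div_pow] at k2
    have k3 : cU⁻¹ * (ell s / s ^ d) ≤ ell t / t ^ d := by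
      calc cU⁻¹ * (ell s / s ^ d) = cU⁻¹ / s ^ d * ell s := by ring
        _ ≤ cU⁻¹ / s ^ d * (cU * (s ^ d / t ^ d) * ell t) :=
            mul_le_mul_of_nonneg_left k2 (by positivity)
        _ = _ := by field_simp
    refine le_trans (mul_le_mul_of_nonneg_right ?_ (by positivity)) k3
    have : (1 : ℝ) ≤ 2 ^ d := one_le_pow₀ (by norm_num)
    rw [div_le_iff₀ (by positivity)]
    refine mul_le_mul_of_nonneg_left ?_ (by positivity)
    linarith
  · have k1 := h.ell_le_of_le_two_mul hs hst h2 hs2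
    have k2 : t ^ d ≤ 2 ^ d * s ^ d := by
      rw [← mul_pow]; exact pow_le_pow_left₀ ht.le h2 d
    have k3 : cL / 4 / 2 ^ d * (ell s / s ^ d) ≤ ell t / t ^ d := by
      calc cL / 4 / 2 ^ d * (ell s / s ^ d) ≤ cL / 4 / 2 ^ d * (4 / cL * ell t / s ^ d) := by
            gcongr
        _ = ell t / (2 ^ d * s ^ d) := by field_simp
        _ ≤ _ := by gcongr
    refine le_trans (mul_le_mul_of_nonneg_right ?_ (by positivity)) k3
    rw [mul_div_assoc]
    exact mul_le_of_le_one_left (by positivity) (inv_le_one_of_one_le₀ hcU)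

/-- After translation the density at y becomes the profile at |y - x|. This lies between |y|/2 and
2|y| and stays below R₀, so the mass of A drops by at most a constant factor. -/
theorem jumpMeasure_preimage_ge (h : IsScale d R₀ ell cL cU γ)
    {A : Set (EuclideanSpace ℝ (Fin d))} (hA : MeasurableSet A)
    {x : EuclideanSpace ℝ (Fin d)} (hA0 : ∀ y ∈ A, 0 < ‖y‖) (hAx : ∀ y ∈ A, 2 * ‖x‖ ≤ ‖y‖)
    (hAR : ∀ y ∈ A, ENNReal.ofReal (2 * ‖y‖) ≤ R₀) :
    ENNReal.ofReal (cU⁻¹ * (cL / 4) / 2 ^ d) * jumpMeasure d R₀ ell A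
      ≤ jumpMeasure d R₀ ell ((x + ·) ⁻¹' A) := by
  have hcU : 0 < cU := zero_lt_one.trans_le h.one_le_cU
  have hcL := h.cL_pos
  rw [jumpMeasure, withDensity_apply _ hA, withDensity_apply _ (measurable_const_add x hA),
    ← lintegral_indicator hA, ← lintegral_indicator (measurable_const_add x hA),
    ← lintegral_const_mul _
      (h.measurable_jumpProfile_norm.ennreal_ofReal.indicator hA)]
  have e : ∀ z, ((x + ·) ⁻¹' A).indicator
      (fun z => ENNReal.ofReal (jumpProfile d R₀ ell ‖z‖)) z
      = (fun y => A.indicator (fun y => ENNReal.ofReal (jumpProfile d R₀ ell ‖y - x‖)) y)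
        (x + z) := by
    intro z
    by_cases hz : x + z ∈ A <;> simp [hz]
  rw [lintegral_congr e, lintegral_add_left_eq_self]
  refine lintegral_mono fun y => ?_
  by_cases hy : y ∈ A
  · simp only [Set.indicator_of_mem hy]
    rw [← ENNReal.ofReal_mul (by positivity)]
    refine ENNReal.ofReal_le_ofReal ?_
    have n1 := norm_sub_norm_le y x
    have n2 := norm_sub_le y x
    have n3 := hAx y hy
    have n4 := hA0 y hy
    have n5 := hAR y hy
    exact h.jumpProfile_comparable n4 (by linarith) (by linarith)
      (mem_scaleInterval_of_lt (by linarith) (by linarith : ‖y - x‖ < 2 * ‖y‖) n5).2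
      (mem_scaleInterval_of_lt n4 (by linarith : ‖y‖ < 2 * ‖y‖) n5).2
  · simp [Set.indicator_of_notMem hy]

/-- Existence of a scale sequence below every admissible radius, with uniform constants. -/
theorem exists_scaleSequence (h : IsScale d R₀ ell cL cU γ) (hd : 1 ≤ d) :
    ∃ a C₁ C₂ g : ℝ, 2 < a ∧ 0 ≤ C₁ ∧ 0 ≤ C₂ ∧ 0 < g ∧
      ∀ ρ : ℝ, 0 < ρ → ENNReal.ofReal (4 * ρ) ≤ R₀ → ∃ r : ℕ → ℝ,
        IsScaleSequence (jumpMeasure d R₀ ell) r a (scaleL R₀ ell ρ) C₁ C₂ g ∧ r 0 ≤ ρ ∧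
          ∀ n, scaleL R₀ ell (r n) = a ^ n * scaleL R₀ ell ρ := by
  have hc := h.cL_pos
  have hcU : 0 < cU := zero_lt_one.trans_le h.one_le_cU
  have hγ : 0 < 2 - γ := by linarith [h.γ_lt_two]
  have hσ := sphereArea_pos hd
  set D : ℝ := 32 / cL ^ 2 + 1 with hD
  have hD1 : 1 < D := by
    have : 0 < 32 / cL ^ 2 := by positivity
    linarith
  -- D is the doubling constant of L. Passing from r_{n+1} to 4r_{n+1} costs D², and the remaining
  -- factor 2 gives L(4r_{n+1}) ≥ 2L(r_n), so the annulus keeps a mass of order L(r_n).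
  set a : ℝ := 2 * D ^ 2 with ha
  have ha2 : 2 < a := by nlinarith
  have ha0 : 0 < a := by linarith
  set C₂ : ℝ := sphereArea d * ((cL * (2 - γ))⁻¹ * (8 / cL) + 4) * a with hC₂
  set c : ℝ := cU⁻¹ * (cL / 4) / 2 ^ d with hcdef
  have hcpos : 0 < c := by positivity
  refine ⟨a, sphereArea d * D, C₂, c * sphereArea d / 2, ha2, by positivity, by positivity,
    by positivity, fun ρ hρ hρR => ?_⟩
  set N := scaleL R₀ ell ρ with hN
  have hNpos : 0 < N := h.scaleL_pos hρ
    ((ENNReal.ofReal_le_ofReal (by linarith)).trans hρR)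
  have hex : ∀ n : ℕ, ∃ s, 0 < s ∧ s ≤ ρ ∧ scaleL R₀ ell s = a ^ n * N := fun n =>
    h.exists_scaleL_eq hρ (le_mul_of_one_le_left hNpos.le (one_le_pow₀ (by linarith)))
  choose r hr0 hrρ hrL using hex
  have hR : ∀ n t, t ≤ 4 * r n → ENNReal.ofReal t ≤ R₀ := fun n t ht =>
    (ENNReal.ofReal_le_ofReal (by linarith [hrρ n])).trans hρR
  have hapos : ∀ n : ℕ, 0 < a ^ n * N := fun n => by positivity
  have hsucc : ∀ n, scaleL R₀ ell (r (n + 1)) = 2 * D ^ 2 * scaleL R₀ ell (r n) := by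
    intro n; rw [hrL, hrL, pow_succ, ha]; ring
  have hfour : ∀ n, 4 * r (n + 1) ≤ r n ∧
      2 * scaleL R₀ ell (r n) ≤ scaleL R₀ ell (4 * r (n + 1)) := by
    intro n
    have hLp : 0 < scaleL R₀ ell (r n) := by rw [hrL]; exact hapos n
    have hDpos : 0 < D := by linarith
    have k1 := h.scaleL_le_scaleL_two_mul (hr0 (n + 1)) (hR (n + 1) _ le_rfl)
    rw [← hD, hsucc] at k1
    have k2 : 2 * D * scaleL R₀ ell (r n) ≤ scaleL R₀ ell (2 * r (n + 1)) := by
      refine le_of_mul_le_mul_left ?_ hDpos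
      calc D * (2 * D * scaleL R₀ ell (r n)) = 2 * D ^ 2 * scaleL R₀ ell (r n) := by ring
        _ ≤ _ := k1
    -- This is needed before the second doubling, which is admissible only if 8r_{n+1} ≤ R₀.
    have k3 : 2 * r (n + 1) < r n := by
      by_contra! hcon
      have := h.scaleL_anti (hr0 n) hcon
      nlinarith
    have k4 := h.scaleL_le_scaleL_two_mul (s := 2 * r (n + 1)) (by linarith [hr0 (n + 1)])
      (hR n _ (by linarith))
    rw [← hD, show 2 * (2 * r (n + 1)) = 4 * r (n + 1) by ring] at k4
    have k5 : 2 * scaleL R₀ ell (r n) ≤ scaleL R₀ ell (4 * r (n + 1)) := by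
      refine le_of_mul_le_mul_left ?_ hDpos
      linarith
    refine ⟨?_, k5⟩
    by_contra! hcon
    have := h.scaleL_anti (hr0 n) hcon.le
    linarith
  refine ⟨r, ⟨hr0, fun n => (hfour n).1, fun s hs => (h.tail_jumpMeasure hd hs).1, fun n => ?_,
    fun n => (h.second_moment_jumpMeasure hd (hr0 _) (hR (n + 1) _ ?_)).1, fun n => ?_,
    fun n S hS => ?_⟩, hrρ 0, hrL⟩
  · rw [(h.tail_jumpMeasure hd (half_pos (hr0 n))).2, mul_assoc]
    refine mul_le_mul_of_nonneg_left ?_ hσ.le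
    have := h.scaleL_le_scaleL_two_mul (half_pos (hr0 n)) (hR n _ (by linarith [hr0 n]))
    rwa [show 2 * (r n / 2) = r n by ring, hrL] at this
  · linarith [hr0 (n + 1)]
  · refine (h.second_moment_jumpMeasure hd (hr0 (n + 1))
      (hR (n + 1) _ (by linarith [hr0 (n + 1)]))).2.trans_eq ?_
    rw [hrL, hC₂, pow_succ]; ring
  · set ν := jumpMeasure d R₀ ell with hν
    -- The cut-off at r_n ensures 2|y| ≤ R₀ on A, as the comparison of translated masses requires.
    set A : Set (EuclideanSpace ℝ (Fin d)) :=
      {y | 4 * r (n + 1) ≤ ‖y‖} \ {y | r n ≤ ‖y‖} with hAdef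
    have hT : ∀ s : ℝ, MeasurableSet {y : EuclideanSpace ℝ (Fin d) | s ≤ ‖y‖} := fun s =>
      measurableSet_le measurable_const measurable_norm
    have hAm : MeasurableSet A := (hT _).diff (hT _)
    have h4pos : 0 < 4 * r (n + 1) := by linarith [hr0 (n + 1)]
    have hTfin := (h.tail_jumpMeasure hd h4pos).1
    have hAν : sphereArea d * (a ^ n * N) ≤ ν.real A := by
      have hsub : {y : EuclideanSpace ℝ (Fin d) | r n ≤ ‖y‖} ⊆ {y | 4 * r (n + 1) ≤ ‖y‖} :=
        fun y hy => (hfour n).1.trans hy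
      rw [hAdef, measureReal_sdiff hsub (hT _) hTfin,
        (h.tail_jumpMeasure hd h4pos).2, (h.tail_jumpMeasure hd (hr0 n)).2, ← mul_sub]
      refine mul_le_mul_of_nonneg_left ?_ hσ.le
      have := (hfour n).2
      rw [hrL] at this ⊢
      linarith
    have main : ∀ S : Set (EuclideanSpace ℝ (Fin d)), MeasurableSet S →
        ν.real A / 2 ≤ ν.real (S ∩ A) → ∀ x : EuclideanSpace ℝ (Fin d), ‖x‖ ≤ 2 * r (n + 1) →
        c * sphereArea d / 2 * (a ^ n * N)
          ≤ ν.real ((x + ·) ⁻¹' (S ∩ {y | 4 * r (n + 1) ≤ ‖y‖})) := by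
      intro S hS hhalf x hx
      have k1 := h.jumpMeasure_preimage_ge (hS.inter hAm) (x := x)
        (fun y hy => h4pos.trans_le hy.2.1) (fun y hy => by
          have : 4 * r (n + 1) ≤ ‖y‖ := hy.2.1
          linarith) (fun y hy => by
          have : ‖y‖ < r n := not_le.1 hy.2.2
          exact hR n _ (by linarith [hr0 n]))
      have hfin : ν ((x + ·) ⁻¹' (S ∩ {y | 4 * r (n + 1) ≤ ‖y‖})) ≠ ⊤ :=
        measure_ne_top_of_subset ((Set.preimage_mono Set.inter_subset_right).trans
          (preimage_tail_subset (t := 2 * r (n + 1)) (by linarith)))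
          (h.tail_jumpMeasure hd (by linarith [hr0 (n + 1)])).1
      have k2 : ν ((x + ·) ⁻¹' (S ∩ A)) ≤ ν ((x + ·) ⁻¹' (S ∩ {y | 4 * r (n + 1) ≤ ‖y‖})) :=
        measure_mono (Set.preimage_mono (Set.inter_subset_inter_right _ Set.sdiff_subset))
      have k3 := ENNReal.toReal_mono hfin (k1.trans k2)
      rw [ENNReal.toReal_mul, ENNReal.toReal_ofReal hcpos.le] at k3
      have k4 : c * (ν.real A / 2) ≤ c * ν.real (S ∩ A) := mul_le_mul_of_nonneg_left hhalf hcpos.le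
      have k5 := mul_le_mul_of_nonneg_left hAν hcpos.le
      calc c * sphereArea d / 2 * (a ^ n * N) ≤ c * ν.real (S ∩ A) := by linarith
        _ ≤ _ := k3
    have hsum : ν.real (S ∩ A) + ν.real (Sᶜ ∩ A) = ν.real A := by
      have := measureReal_inter_add_sdiff (μ := ν) (s := A) hS
        (measure_ne_top_of_subset Set.sdiff_subset hTfin)
      rw [← this, Set.inter_comm A S, Set.sdiff_eq, Set.inter_comm A Sᶜ]
    rcases le_total (ν.real A / 2) (ν.real (S ∩ A)) with hh | hh
    · exact Or.inl (main S hS hh)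
    · exact Or.inr (main Sᶜ hS.compl (by linarith))

end IsScale

end JumpMeasure

/-! ### From oscillation decay to the modulus of continuity. -/

section Regularity

variable {d : ℕ} {R₀ : ℝ≥0∞} {ell : ℝ → ℝ} {cL cU γ : ℝ}

/-- A choice of the parameters in the oscillation decay. -/
theorem exists_decay_parameters {κ a C₁ C₂ g : ℝ} (hκ : 1 ≤ κ) (ha : 2 < a) (hC₁ : 0 ≤ C₁)
    (hC₂ : 0 ≤ C₂) (hg : 0 < g) :
    ∃ b p θ : ℝ, 1 < b ∧ 2 * b ≤ a ∧ 0 < p ∧ 2 * (1 - b⁻¹) ≤ θ ∧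
      p + κ * (8 * (b - 1) * C₁ + θ * C₂) < κ⁻¹ * (2 * g) := by
  have hκ0 : 0 < κ := by linarith
  have hg' : 0 < κ⁻¹ * g := by positivity
  have hQ : 0 < κ * (8 * C₁ + 2 * C₂ + 1) := by positivity
  -- With p = κ⁻¹g, half of the available gain 2κ⁻¹g remains. The other terms are linear in t, for b
  -- = 1 + t and θ = 2t, so a small t suffices.
  set t := min ((a - 2) / 2) (κ⁻¹ * g / (2 * (κ * (8 * C₁ + 2 * C₂ + 1)))) with ht
  have ht0 : 0 < t := lt_min (by linarith) (by positivity)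
  have ht1 : t ≤ (a - 2) / 2 := min_le_left _ _
  have ht2 : t * (2 * (κ * (8 * C₁ + 2 * C₂ + 1))) ≤ κ⁻¹ * g :=
    (le_div_iff₀ (by positivity)).1 (min_le_right _ _)
  refine ⟨1 + t, κ⁻¹ * g, 2 * t, by linarith, by linarith, hg', ?_, ?_⟩
  · have h1 : 0 < 1 + t := by linarith
    have h2 : 1 - (1 + t)⁻¹ = t / (1 + t) := by field_simp; ring
    rw [h2]
    have := div_le_self ht0.le (by linarith : 1 ≤ 1 + t)
    linarith
  · have h3 : κ * (8 * (1 + t - 1) * C₁ + 2 * t * C₂)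
        = t * (κ * (8 * C₁ + 2 * C₂ + 1)) - t * κ := by ring
    have h4 : 0 < t * κ := by positivity
    rw [h3]
    linarith

/-- Regularity at the origin for functions satisfying both extremal inequalities. -/
theorem IsScale.regularity_at_zero (h : IsScale d R₀ ell cL cU γ) (hd : 1 ≤ d) {κ : ℝ}
    (hκ : 1 ≤ κ) :
    ∃ C β : ℝ, 0 < C ∧ 0 < β ∧ β < 1 ∧ ∀ ρ : ℝ, 0 < ρ → ENNReal.ofReal (4 * ρ) ≤ R₀ →
      ∀ u : EuclideanSpace ℝ (Fin d) → ℝ, Continuous u →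
      (∀ x, Integrable (secondDiff u x) (jumpMeasure d R₀ ell)) →
      ∀ M G : ℝ, 0 < M → (∀ y, |u y| ≤ M) → 0 ≤ G →
      (∀ x, ‖x‖ < ρ → -G ≤ ∫ z, pucci κ (secondDiff u x z) ∂(jumpMeasure d R₀ ell)) →
      (∀ x, ‖x‖ < ρ → -G ≤ ∫ z, pucci κ (-secondDiff u x z) ∂(jumpMeasure d R₀ ell)) →
      ∀ y, y ≠ 0 → ‖y‖ < ρ → |u y - u 0| * scaleL R₀ ell ‖y‖ ^ β ≤
        C * scaleL R₀ ell ρ ^ β * (M + G / scaleL R₀ ell ρ) := by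
  obtain ⟨a, C₁, C₂, g, ha, hC₁, hC₂, hg, hseq⟩ := h.exists_scaleSequence hd
  obtain ⟨b, p, θ, hb, hab, hp, hθ, hsmall⟩ := exists_decay_parameters hκ ha hC₁ hC₂ hg
  have ha1 : 1 < a := by linarith
  have hb0 : 0 < b := by linarith
  have hβ0 : 0 < Real.logb a b := Real.logb_pos ha1 hb
  have hβ1 : Real.logb a b < 1 := by
    rw [Real.logb_lt_iff_lt_rpow ha1 hb0, Real.rpow_one]; linarith
  have hab' : a ^ Real.logb a b = b := Real.rpow_logb (by linarith) ha1.ne' hb0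
  refine ⟨2 * b * (1 + p⁻¹), Real.logb a b, by positivity, hβ0, hβ1, ?_⟩
  intro ρ hρ hρR u hu hui M G hM huM hG hM1 hM2 y hy0 hyρ
  set β := Real.logb a b with hβ
  obtain ⟨r, H, hr0, hrL⟩ := hseq ρ hρ hρR
  set N := scaleL R₀ ell ρ with hN
  have hNpos : 0 < N := h.scaleL_pos hρ
    ((ENNReal.ofReal_le_ofReal (by linarith)).trans hρR)
  have hNβ : 0 < N ^ β := Real.rpow_pos_of_pos hNpos _
  have hyn : 0 < ‖y‖ := norm_pos_iff.2 hy0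
  -- The least convenient size that bounds |u| and also makes G at most D p N.
  set D := M + G / (p * N) with hDdef
  have hDM : M ≤ D := by
    have : 0 ≤ G / (p * N) := by positivity
    linarith
  have hD : 0 < D := by linarith
  have hDG : G ≤ D * p * N := by
    have : D * p * N = M * p * N + G := by rw [hDdef]; field_simp
    have : 0 ≤ M * p * N := by positivity
    linarith
  have hDle : D ≤ (1 + p⁻¹) * (M + G / N) := by
    have e : (1 + p⁻¹) * (M + G / N) = D + G / N + p⁻¹ * M := by rw [hDdef]; field_simp; ring
    have : 0 ≤ G / N := by positivity
    have : 0 ≤ p⁻¹ * M := by positivity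
    linarith
  have hr0' : ∀ x : EuclideanSpace ℝ (Fin d), ‖x‖ < r 0 → ‖x‖ < ρ := fun x hx =>
    hx.trans_le hr0
  have hdecay := H.oscillation_decay hκ hb hab hNpos hC₁ hp.le hθ hsmall hD hu hui
    (fun y => (huM y).trans hDM) (fun x hx => by linarith [hM1 x (hr0' x hx)])
    (fun x hx => by linarith [hM2 x (hr0' x hx)])
  have hLy : 0 ≤ scaleL R₀ ell ‖y‖ := h.scaleL_nonneg hyn
  have hfin : |u y - u 0| * scaleL R₀ ell ‖y‖ ^ β ≤ 2 * b * D * N ^ β := by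
    have hex : ∃ n, r n ≤ ‖y‖ := by
      obtain ⟨n, hn⟩ := pow_unbounded_of_one_lt (scaleL R₀ ell ‖y‖ / N) ha1
      refine ⟨n, ?_⟩
      by_contra! hcon
      have h1 := h.scaleL_anti hyn hcon.le
      rw [hrL] at h1
      rw [div_lt_iff₀ hNpos] at hn
      linarith
    classical
    -- The first n with r_n ≤ |y|. If it is 0, the sup bound suffices. Otherwise y lies in the
    -- preceding ball, where the decay estimate holds without excess; the lag of one index costs the
    -- factor b in the constant.
    rcases hn : Nat.find hex with _ | n
    · have h0 : r 0 ≤ ‖y‖ := hn ▸ Nat.find_spec hex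
      have h1 := h.scaleL_anti (H.pos 0) h0
      rw [hrL, pow_zero, one_mul] at h1
      have h2 : |u y - u 0| ≤ 2 * D := by
        have := abs_sub (u y) (u 0)
        linarith [huM y, huM 0]
      calc |u y - u 0| * scaleL R₀ ell ‖y‖ ^ β ≤ 2 * D * N ^ β :=
            mul_le_mul h2 (Real.rpow_le_rpow hLy h1 hβ0.le) (Real.rpow_nonneg hLy _)
              (by positivity)
        _ ≤ 2 * b * D * N ^ β := by
            refine mul_le_mul_of_nonneg_right ?_ hNβ.le
            nlinarith
    · have h0 : r (n + 1) ≤ ‖y‖ := hn ▸ Nat.find_spec hex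
      have h1 : ‖y‖ < r n := not_le.1 (Nat.find_min hex (by omega))
      have h2 := h.scaleL_anti (H.pos _) h0
      rw [hrL] at h2
      obtain ⟨c, hc⟩ := hdecay n
      have h3 := hc y
      have h4 := hc 0
      rw [growthExcess_eq_zero b H.antitone n h1, add_zero, mul_one] at h3
      rw [growthExcess_eq_zero b H.antitone n (by rw [norm_zero]; exact H.pos n), add_zero,
        mul_one] at h4
      have h5 : |u y - u 0| ≤ 2 * (D * (b ^ n)⁻¹) := by
        have e : u y - u 0 = (u y - c) - (u 0 - c) := by ring
        rw [e]
        have := abs_sub (u y - c) (u 0 - c)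
        linarith
      have h6 : (a ^ (n + 1) * N) ^ β = b ^ (n + 1) * N ^ β := by
        rw [Real.mul_rpow (by positivity) hNpos.le, ← Real.rpow_natCast a, ← Real.rpow_mul
          (by linarith), mul_comm (((n + 1 : ℕ) : ℝ)) β, Real.rpow_mul (by linarith), hab',
          Real.rpow_natCast]
      calc |u y - u 0| * scaleL R₀ ell ‖y‖ ^ β
          ≤ 2 * (D * (b ^ n)⁻¹) * (b ^ (n + 1) * N ^ β) := by
            refine mul_le_mul h5 ?_ (Real.rpow_nonneg hLy _) (by positivity)
            rw [← h6]
            exact Real.rpow_le_rpow hLy h2 hβ0.le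
        _ = 2 * b * D * N ^ β := by
            rw [pow_succ]; field_simp
  refine hfin.trans ?_
  have := mul_le_mul_of_nonneg_left hDle (by positivity : 0 ≤ 2 * b * N ^ β)
  linarith

end Regularity

/-! ### From the equation to extremal inequalities. -/

section Reduction

variable {d : ℕ} {R₀ : ℝ≥0∞} {ell : ℝ → ℝ} {cL cU γ κ K₀ : ℝ}

local notation "𝔼" d => EuclideanSpace ℝ (Fin d)

theorem IsC2b.exists_taylor_bound {u : (𝔼 d) → ℝ} (hu : IsC2b u) :
    ∃ C : ℝ, 0 ≤ C ∧ (∀ x, |u x| ≤ C) ∧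
      ∀ x h, |u (x + h) - u x - inner ℝ (gradient u x) h| ≤ C * ‖h‖ ^ 2 := by
  obtain ⟨C, hC⟩ := hu.bounded
  have h0 : ∀ x, |u x| ≤ C := fun x => by
    have := hC 0 (by norm_num) x
    rwa [norm_iteratedFDeriv_zero] at this
  have h2 : ∀ x, ‖fderiv ℝ (fderiv ℝ u) x‖ ≤ C := fun x => by
    have := hC 2 le_rfl x
    rwa [← norm_iteratedFDeriv_fderiv, norm_iteratedFDeriv_one] at this
  have hC0 : 0 ≤ C := (abs_nonneg _).trans (h0 0)
  have hd1 : Differentiable ℝ u := hu.contDiff.differentiable (by norm_num)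
  have hd2 : Differentiable ℝ (fderiv ℝ u) :=
    (hu.contDiff.fderiv_right (m := 1) (by norm_num)).differentiable (by norm_num)
  refine ⟨C, hC0, h0, fun x h => ?_⟩
  rw [inner_gradient_left]
  have hlip : ∀ z ∈ Metric.closedBall x ‖h‖, ‖fderiv ℝ u z - fderiv ℝ u x‖ ≤ C * ‖h‖ := by
    intro z hz
    have := convex_univ.norm_image_sub_le_of_norm_fderiv_le (f := fderiv ℝ u) (C := C)
      (fun y _ => hd2 y) (fun y _ => h2 y) (Set.mem_univ x) (Set.mem_univ z)
    refine this.trans (mul_le_mul_of_nonneg_left ?_ hC0)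
    rwa [← dist_eq_norm]
  have := (convex_closedBall x ‖h‖).norm_image_sub_le_of_norm_fderiv_le' (f := u)
    (φ := fderiv ℝ u x) (fun y _ => hd1 y) hlip (Metric.mem_closedBall_self (norm_nonneg h))
    (y := x + h) (by simp)
  rw [add_sub_cancel_left, Real.norm_eq_abs] at this
  calc _ ≤ C * ‖h‖ * ‖h‖ := this
    _ = _ := by ring

/-- The second differences are bounded by a multiple of `1 ∧ |h|²`. -/
theorem IsC2b.exists_secondDiff_bound {u : (𝔼 d) → ℝ} (hu : IsC2b u) :
    ∃ C : ℝ, 0 ≤ C ∧ ∀ x h, |secondDiff u x h| ≤ C * min 1 (‖h‖ ^ 2) := by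
  obtain ⟨C, hC0, h0, hT⟩ := hu.exists_taylor_bound
  refine ⟨4 * C, by positivity, fun x h => ?_⟩
  rcases min_choice 1 (‖h‖ ^ 2) with hm | hm <;> rw [hm]
  · unfold secondDiff
    have h1 := abs_le.1 (h0 (x + h))
    have h2 := abs_le.1 (h0 (x - h))
    have h3 := abs_le.1 (h0 x)
    exact abs_le.2 ⟨by linarith, by linarith⟩
  · have h1 := abs_le.1 (hT x h)
    have h2 := abs_le.1 (hT x (-h))
    rw [inner_neg_right, norm_neg, ← sub_eq_add_neg] at h2
    have h3 : 0 ≤ C * ‖h‖ ^ 2 := by positivity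
    unfold secondDiff
    exact abs_le.2 ⟨by linarith, by linarith⟩

theorem continuous_secondDiff {u : (𝔼 d) → ℝ} (hu : Continuous u) :
    Continuous (Function.uncurry (secondDiff u)) := by
  unfold secondDiff Function.uncurry
  fun_prop

theorem IsScale.integrable_min_one_sq (h : IsScale d R₀ ell cL cU γ) (hd : 1 ≤ d)
    (hR₀ : 0 < R₀) :
    Integrable (fun x : 𝔼 d => min 1 (‖x‖ ^ 2)) (jumpMeasure d R₀ ell) := by
  -- With s ≤ 1 the weight 1 ∧ |x|² is at most 4 ∧ |x|²/s², whose integral is already controlled.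
  obtain ⟨s, hs0, hs1, hsR⟩ : ∃ s : ℝ, 0 < s ∧ s ≤ 1 ∧ ENNReal.ofReal (2 * s) ≤ R₀ := by
    rcases eq_or_ne R₀ ⊤ with hR | hR
    · exact ⟨1, one_pos, le_rfl, by simp [hR]⟩
    · have hp : 0 < R₀.toReal := ENNReal.toReal_pos hR₀.ne' hR
      refine ⟨min 1 (R₀.toReal / 2), by positivity, min_le_left _ _, ?_⟩
      rw [ENNReal.ofReal_le_iff_le_toReal hR]
      linarith [min_le_right 1 (R₀.toReal / 2)]
  refine Integrable.mono' (h.second_moment_jumpMeasure hd hs0 hsR).1 ?_ ?_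
  · exact (continuous_const.min (continuous_norm.pow 2)).aestronglyMeasurable
  · refine Filter.Eventually.of_forall fun x => ?_
    rw [Real.norm_eq_abs, abs_of_nonneg (le_min zero_le_one (by positivity))]
    refine min_le_min (by norm_num) ?_
    rw [le_div_iff₀ (by positivity)]
    exact mul_le_of_le_one_right (by positivity) (pow_le_one₀ hs0.le hs1)

theorem IsScale.integrable_of_le_min (h : IsScale d R₀ ell cL cU γ) (hd : 1 ≤ d)
    (hR₀ : 0 < R₀) {t : (𝔼 d) → ℝ} (htm : Measurable t) {C : ℝ}
    (ht : ∀ x, |t x| ≤ C * min 1 (‖x‖ ^ 2)) : Integrable t (jumpMeasure d R₀ ell) :=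
  ((h.integrable_min_one_sq hd hR₀).const_mul C).mono' htm.aestronglyMeasurable
    (Filter.Eventually.of_forall ht)

/-- Dominated convergence applies because ν does not depend on x. The operator itself may be
discontinuous in x, so continuity becomes available only after passing to the extremal form. -/
theorem IsScale.continuous_integral_pucci (h : IsScale d R₀ ell cL cU γ) (hd : 1 ≤ d)
    (hR₀ : 0 < R₀) (hκ : 1 ≤ κ) {t : (𝔼 d) → (𝔼 d) → ℝ}
    (htc : Continuous (Function.uncurry t)) {C : ℝ}
    (ht : ∀ x z, |t x z| ≤ C * min 1 (‖z‖ ^ 2)) :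
    Continuous fun x => ∫ z, pucci κ (t x z) ∂(jumpMeasure d R₀ ell) := by
  refine continuous_of_dominated (bound := fun z => κ * (C * min 1 (‖z‖ ^ 2)))
    (fun x => ?_) (fun x => Filter.Eventually.of_forall fun z => ?_)
    (((h.integrable_min_one_sq hd hR₀).const_mul C).const_mul κ)
    (Filter.Eventually.of_forall fun z => ?_)
  · exact ((continuous_pucci κ).comp
      (htc.comp (continuous_const.prodMk continuous_id))).aestronglyMeasurable
  · exact (abs_pucci_le hκ _).trans
      (mul_le_mul_of_nonneg_left (ht x z) (by linarith))
  · exact (continuous_pucci κ).comp (htc.comp (continuous_id.prodMk continuous_const))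

/-- The kernel, set to zero on the diagonal. -/
noncomputable def offDiagKernel (K : (𝔼 d) → (𝔼 d) → ℝ) (x : 𝔼 d) : (𝔼 d) → ℝ :=
  {h | h ≠ 0}.indicator (K x)

theorem offDiagKernel_of_ne (K : (𝔼 d) → (𝔼 d) → ℝ) (x : 𝔼 d) {h : 𝔼 d} (hh : h ≠ 0) :
    offDiagKernel K x h = K x h := Set.indicator_of_mem (s := {h | h ≠ 0}) hh _

theorem offDiagKernel_zero (K : (𝔼 d) → (𝔼 d) → ℝ) (x : 𝔼 d) :
    offDiagKernel K x 0 = 0 := Set.indicator_of_notMem (s := {h | h ≠ 0}) (by simp) _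

theorem measurableSet_ne_zero : MeasurableSet {h : 𝔼 d | h ≠ 0} :=
  (measurableSet_singleton (0 : 𝔼 d)).compl

namespace IsKernel

variable {K : (𝔼 d) → (𝔼 d) → ℝ}

theorem measurable_offDiagKernel (hK : IsKernel d R₀ ell κ K₀ K) (x : 𝔼 d) :
    Measurable (offDiagKernel K x) := by
  refine measurable_of_restrict_of_restrict_compl measurableSet_ne_zero ?_ ?_
  · have hf : Measurable fun h : {h : 𝔼 d | h ≠ 0} =>
        (⟨(x, h.1), h.2⟩ : {p : (𝔼 d) × (𝔼 d) | p.2 ≠ 0}) :=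
      (measurable_const.prodMk measurable_subtype_coe).subtype_mk
    convert hK.measurable.comp hf using 1
    ext h
    exact offDiagKernel_of_ne K x h.2
  · convert measurable_const (a := (0 : ℝ)) using 1
    ext h
    exact Set.indicator_of_notMem h.2 _

theorem offDiagKernel_nonneg (hK : IsKernel d R₀ ell κ K₀ K) (x h : 𝔼 d) :
    0 ≤ offDiagKernel K x h :=
  Set.indicator_nonneg (fun z hz => hK.nonneg x z hz) h

theorem offDiagKernel_neg (hK : IsKernel d R₀ ell κ K₀ K) (x h : 𝔼 d) :
    offDiagKernel K x (-h) = offDiagKernel K x h := by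
  by_cases hh : h = 0
  · simp [hh]
  · rw [offDiagKernel_of_ne K x hh, offDiagKernel_of_ne K x (neg_ne_zero.2 hh), hK.symm x h hh]

theorem levy_integrable (hK : IsKernel d R₀ ell κ K₀ K) (hK₀ : 0 ≤ K₀) (x : 𝔼 d) :
    Integrable (fun h => min 1 (‖h‖ ^ 2) * offDiagKernel K x h) ∧
      ∫ h, min 1 (‖h‖ ^ 2) * offDiagKernel K x h ≤ K₀ := by
  have hnn : ∀ h : 𝔼 d, 0 ≤ min 1 (‖h‖ ^ 2) * offDiagKernel K x h := fun h =>
    mul_nonneg (le_min zero_le_one (by positivity)) (hK.offDiagKernel_nonneg x h)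
  have hm : Measurable fun h : 𝔼 d => min 1 (‖h‖ ^ 2) * offDiagKernel K x h :=
    (measurable_const.min (measurable_norm.pow_const 2)).mul (hK.measurable_offDiagKernel x)
  have hle : ∫⁻ h, ENNReal.ofReal (min 1 (‖h‖ ^ 2) * offDiagKernel K x h)
      ≤ ENNReal.ofReal K₀ := by
    refine le_of_eq_of_le ?_ (hK.levy_bound x)
    rw [← lintegral_indicator measurableSet_ne_zero]
    refine lintegral_congr fun h => ?_
    by_cases hh : h = 0
    · simp [hh]
    · rw [Set.indicator_of_mem (show h ∈ {h : 𝔼 d | h ≠ 0} from hh), offDiagKernel_of_ne K x hh]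
  have hi : Integrable (fun h => min 1 (‖h‖ ^ 2) * offDiagKernel K x h) := by
    refine ⟨hm.aestronglyMeasurable, ?_⟩
    rw [hasFiniteIntegral_iff_ofReal (Filter.Eventually.of_forall hnn)]
    exact hle.trans_lt ENNReal.ofReal_lt_top
  refine ⟨hi, ?_⟩
  rw [← ofReal_integral_eq_lintegral_ofReal hi (Filter.Eventually.of_forall hnn)] at hle
  exact (ENNReal.ofReal_le_ofReal_iff hK₀).1 hle

theorem integrable_mul (hK : IsKernel d R₀ ell κ K₀ K) (hK₀ : 0 ≤ K₀) (x : 𝔼 d)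
    {t : (𝔼 d) → ℝ} (htm : Measurable t) {C : ℝ} (ht : ∀ h, |t h| ≤ C * min 1 (‖h‖ ^ 2)) :
    Integrable fun h => t h * offDiagKernel K x h := by
  refine ((hK.levy_integrable hK₀ x).1.const_mul C).mono'
    (htm.mul (hK.measurable_offDiagKernel x)).aestronglyMeasurable
    (Filter.Eventually.of_forall fun h => ?_)
  rw [norm_mul, Real.norm_eq_abs, Real.norm_eq_abs, abs_of_nonneg (hK.offDiagKernel_nonneg x h),
    ← mul_assoc]
  exact mul_le_mul_of_nonneg_right (ht h) (hK.offDiagKernel_nonneg x h)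

/-- Averaging the integrand over h and -h cancels the gradient term, because both K(x,·) and B₁ are
symmetric. -/
theorem two_mul_nonlocalOp (hK : IsKernel d R₀ ell κ K₀ K) (hK₀ : 0 ≤ K₀)
    {u : (𝔼 d) → ℝ} (hu : IsC2b u) (x : 𝔼 d) :
    2 * nonlocalOp K u x = ∫ h, secondDiff u x h * offDiagKernel K x h := by
  obtain ⟨C, hC0, h0, hT⟩ := hu.exists_taylor_bound
  set t : (𝔼 d) → ℝ := fun h => u (x + h) - u x
    - (Metric.ball (0 : 𝔼 d) 1).indicator (fun h => inner ℝ (gradient u x) h) h with htdef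
  have hop : nonlocalOp K u x = ∫ h, t h * offDiagKernel K x h := by
    rw [nonlocalOp, ← integral_indicator measurableSet_ne_zero]
    refine integral_congr_ae (Filter.Eventually.of_forall fun h => ?_)
    by_cases hh : h = 0
    · simp [hh, offDiagKernel_zero]
    · simp only [Set.indicator_of_mem (show h ∈ {h : 𝔼 d | h ≠ 0} from hh),
        offDiagKernel_of_ne K x hh, htdef]
  have huc : Continuous u := hu.contDiff.continuous
  have htm : Measurable t := by
    refine Measurable.sub ?_ ?_
    · exact (by fun_prop : Continuous fun h => u (x + h) - u x).measurable
    · exact (by fun_prop : Continuous fun h : 𝔼 d => inner ℝ (gradient u x) h).measurable.indicator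
        measurableSet_ball
  have htb : ∀ h, |t h| ≤ 2 * C * min 1 (‖h‖ ^ 2) := by
    intro h
    by_cases hh : ‖h‖ < 1
    · have h1 : min 1 (‖h‖ ^ 2) = ‖h‖ ^ 2 := min_eq_right (pow_le_one₀ (norm_nonneg h) hh.le)
      have h2 := hT x h
      have h3 : 0 ≤ C * ‖h‖ ^ 2 := by positivity
      simp only [htdef]
      rw [Set.indicator_of_mem (by simpa using hh), h1]
      linarith
    · have h1 : min 1 (‖h‖ ^ 2) = 1 := min_eq_left (one_le_pow₀ (not_lt.1 hh))
      simp only [htdef]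
      rw [Set.indicator_of_notMem (by simpa using hh), h1, sub_zero]
      have := abs_sub (u (x + h)) (u x)
      linarith [h0 (x + h), h0 x]
  have hi := hK.integrable_mul hK₀ x htm htb
  have hi' : Integrable fun h => t (-h) * offDiagKernel K x h := by
    have := hi.comp_neg
    simpa only [hK.offDiagKernel_neg] using this
  have e1 : ∫ h, t (-h) * offDiagKernel K x h = ∫ h, t h * offDiagKernel K x h := by
    have := integral_neg_eq_self (fun h => t h * offDiagKernel K x h) volume
    simpa only [hK.offDiagKernel_neg] using this
  have e2 : ∀ h, secondDiff u x h * offDiagKernel K x h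
      = t h * offDiagKernel K x h + t (-h) * offDiagKernel K x h := by
    intro h
    have : secondDiff u x h = t h + t (-h) := by
      by_cases hh : ‖h‖ < 1
      · simp only [htdef, secondDiff]
        rw [Set.indicator_of_mem (by simpa using hh), Set.indicator_of_mem (by simpa using hh),
          inner_neg_right, ← sub_eq_add_neg]
        ring
      · simp only [htdef, secondDiff]
        rw [Set.indicator_of_notMem (by simpa using hh),
          Set.indicator_of_notMem (by simpa using hh), ← sub_eq_add_neg]
        ring
    rw [this, add_mul]
  rw [integral_congr_ae (Filter.Eventually.of_forall e2), integral_add hi hi', e1, hop]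
  ring

/-- The mass of the kernel outside of `B_{R₀}`. -/
theorem integral_far_le (hK : IsKernel d R₀ ell κ K₀ K) (hK₀ : 0 ≤ K₀) (hR₀ : 0 < R₀)
    (hR : R₀ ≠ ⊤) (x : 𝔼 d) :
    Integrable ({h : 𝔼 d | R₀ ≤ ENNReal.ofReal ‖h‖}.indicator (offDiagKernel K x)) ∧
      ∫ h, {h : 𝔼 d | R₀ ≤ ENNReal.ofReal ‖h‖}.indicator (offDiagKernel K x) h
        ≤ (min 1 (R₀.toReal ^ 2))⁻¹ * K₀ := by
  have hp : 0 < R₀.toReal := ENNReal.toReal_pos hR₀.ne' hR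
  have hm : 0 < min 1 (R₀.toReal ^ 2) := by positivity
  obtain ⟨i1, i2⟩ := hK.levy_integrable hK₀ x
  have hpt : ∀ h : 𝔼 d, {h : 𝔼 d | R₀ ≤ ENNReal.ofReal ‖h‖}.indicator (offDiagKernel K x) h
      ≤ (min 1 (R₀.toReal ^ 2))⁻¹ * (min 1 (‖h‖ ^ 2) * offDiagKernel K x h) := by
    intro h
    have hk := hK.offDiagKernel_nonneg x h
    by_cases hh : R₀ ≤ ENNReal.ofReal ‖h‖
    · rw [Set.indicator_of_mem (show h ∈ {h : 𝔼 d | R₀ ≤ ENNReal.ofReal ‖h‖} from hh),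
        ← mul_assoc]
      refine le_mul_of_one_le_left hk ?_
      rw [← div_eq_inv_mul, one_le_div hm]
      have : R₀.toReal ≤ ‖h‖ := (ENNReal.le_ofReal_iff_toReal_le hR (norm_nonneg h)).1 hh
      exact min_le_min le_rfl (pow_le_pow_left₀ hp.le this 2)
    · rw [Set.indicator_of_notMem (show h ∉ {h : 𝔼 d | R₀ ≤ ENNReal.ofReal ‖h‖} from hh)]
      have : 0 ≤ min 1 (‖h‖ ^ 2) := le_min zero_le_one (by positivity)
      positivity
  have hms : MeasurableSet {h : 𝔼 d | R₀ ≤ ENNReal.ofReal ‖h‖} :=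
    measurableSet_le measurable_const measurable_norm.ennreal_ofReal
  have hi : Integrable
      ({h : 𝔼 d | R₀ ≤ ENNReal.ofReal ‖h‖}.indicator (offDiagKernel K x)) := by
    refine (i1.const_mul (min 1 (R₀.toReal ^ 2))⁻¹).mono'
      ((hK.measurable_offDiagKernel x).indicator hms).aestronglyMeasurable
      (Filter.Eventually.of_forall fun h => ?_)
    rw [Real.norm_eq_abs, abs_of_nonneg
      (Set.indicator_nonneg (fun z _ => hK.offDiagKernel_nonneg x z) h)]
    exact hpt h
  refine ⟨hi, (integral_mono hi (i1.const_mul _) hpt).trans ?_⟩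
  rw [integral_const_mul]
  exact mul_le_mul_of_nonneg_left i2 (inv_nonneg.2 hm.le)

/-- Uniform bound of the far mass in terms of the intrinsic scale. -/
theorem exists_far_mass (h : IsScale d R₀ ell cL cU γ) (hR₀ : 0 < R₀) (hK₀ : 0 ≤ K₀) :
    ∃ T : ℝ, 0 ≤ T ∧ ∀ K : (𝔼 d) → (𝔼 d) → ℝ, IsKernel d R₀ ell κ K₀ K → ∀ r : ℝ, 0 < r →
      ENNReal.ofReal (2 * r) ≤ R₀ → ∀ x : 𝔼 d,
      Integrable ({h : 𝔼 d | R₀ ≤ ENNReal.ofReal ‖h‖}.indicator (offDiagKernel K x)) ∧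
        ∫ h, {h : 𝔼 d | R₀ ≤ ENNReal.ofReal ‖h‖}.indicator (offDiagKernel K x) h
          ≤ T * scaleL R₀ ell r := by
  rcases eq_or_ne R₀ ⊤ with hR | hR
  · refine ⟨0, le_rfl, fun K _ r _ _ x => ?_⟩
    have : {h : 𝔼 d | R₀ ≤ ENNReal.ofReal ‖h‖} = ∅ := by
      rw [hR]; ext h; simp
    rw [this]
    simp
  -- The far mass is an absolute constant. Since r ≤ R₀/2 and L is nonincreasing, it is a multiple
  -- of L(r) through the positive number L(R₀/2).
  · have hp : 0 < R₀.toReal := ENNReal.toReal_pos hR₀.ne' hR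
    have hL : 0 < scaleL R₀ ell (R₀.toReal / 2) := h.scaleL_pos (half_pos hp) (by
      rw [mul_div_cancel₀ _ (two_ne_zero), ENNReal.ofReal_toReal hR])
    refine ⟨(min 1 (R₀.toReal ^ 2))⁻¹ * K₀ / scaleL R₀ ell (R₀.toReal / 2), by positivity,
      fun K hK r hr hrR x => ?_⟩
    obtain ⟨i1, i2⟩ := hK.integral_far_le hK₀ hR₀ hR x
    refine ⟨i1, i2.trans ?_⟩
    rw [ENNReal.ofReal_le_iff_le_toReal hR] at hrR
    have h1 := h.scaleL_anti hr (by linarith : r ≤ R₀.toReal / 2)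
    rw [div_mul_eq_mul_div, le_div_iff₀ hL]
    exact mul_le_mul_of_nonneg_left h1 (by positivity)

/-- Inside B_{R₀} the upper kernel bound is used where t ≥ 0 and the lower one where t ≤ 0, which
produces the extremal function. Outside B_{R₀} only |t| ≤ M is used. -/
theorem integral_mul_le (h : IsScale d R₀ ell cL cU γ) (hd : 1 ≤ d) (hR₀ : 0 < R₀)
    (hK : IsKernel d R₀ ell κ K₀ K) (hκ : 1 ≤ κ) (hK₀ : 0 ≤ K₀) (x : 𝔼 d) {t : (𝔼 d) → ℝ}
    (htm : Measurable t) {C M B : ℝ} (ht : ∀ z, |t z| ≤ C * min 1 (‖z‖ ^ 2))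
    (htM : ∀ z, |t z| ≤ M)
    (hBi : Integrable ({h : 𝔼 d | R₀ ≤ ENNReal.ofReal ‖h‖}.indicator (offDiagKernel K x)))
    (hB : ∫ h, {h : 𝔼 d | R₀ ≤ ENNReal.ofReal ‖h‖}.indicator (offDiagKernel K x) h ≤ B) :
    ∫ z, t z * offDiagKernel K x z ≤
      (∫ z, pucci κ (t z) ∂(jumpMeasure d R₀ ell)) + M * B := by
  have hκ0 : 0 < κ := by linarith
  have hM : 0 ≤ M := (abs_nonneg _).trans (htM 0)
  have hi := hK.integrable_mul hK₀ x htm ht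
  have hp := integrable_pucci hκ (h.integrable_of_le_min hd hR₀ htm ht)
  rw [h.integrable_jumpMeasure_iff] at hp
  rw [h.integral_jumpMeasure]
  have hpt : ∀ z, t z * offDiagKernel K x z ≤ jumpProfile d R₀ ell ‖z‖ * pucci κ (t z)
      + M * {h : 𝔼 d | R₀ ≤ ENNReal.ofReal ‖h‖}.indicator (offDiagKernel K x) z := by
    intro z
    by_cases hz : z = 0
    · have h1 : t z = 0 := by
        have := ht z
        rw [hz, norm_zero] at this
        rw [hz]
        simpa using this
      have h2 : 0 ≤ {h : 𝔼 d | R₀ ≤ ENNReal.ofReal ‖h‖}.indicator (offDiagKernel K x) z :=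
        Set.indicator_nonneg (fun z _ => hK.offDiagKernel_nonneg x z) z
      have h3 : pucci κ 0 = 0 := by simp [pucci]
      rw [h1, h3]
      have := mul_nonneg hM h2
      linarith
    have hzn : 0 < ‖z‖ := norm_pos_iff.2 hz
    by_cases hR : R₀ ≤ ENNReal.ofReal ‖z‖
    · have h1 : jumpProfile d R₀ ell ‖z‖ = 0 := by
        rw [jumpProfile, Set.indicator_of_notMem (fun hm => not_lt.2 hR hm.2), zero_div]
      rw [h1, zero_mul, zero_add,
        Set.indicator_of_mem (show z ∈ {h : 𝔼 d | R₀ ≤ ENNReal.ofReal ‖h‖} from hR)]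
      exact mul_le_mul_of_nonneg_right ((le_abs_self _).trans (htM z))
        (hK.offDiagKernel_nonneg x z)
    · rw [Set.indicator_of_notMem (show z ∉ {h : 𝔼 d | R₀ ≤ ENNReal.ofReal ‖h‖} from hR),
        mul_zero, add_zero, offDiagKernel_of_ne K x hz]
      have hR' := not_le.1 hR
      have h1 : jumpProfile d R₀ ell ‖z‖ = ell ‖z‖ / ‖z‖ ^ d := by
        rw [jumpProfile, Set.indicator_of_mem (show ‖z‖ ∈ scaleInterval R₀ from ⟨hzn, hR'⟩)]
      have hJ := h.jumpProfile_nonneg hzn.le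
      have hlo := hK.lower_bound x z hz hR'
      have hup := hK.upper_bound x z hz hR'
      rw [← h1] at hlo hup
      rcases le_total 0 (t z) with ht0 | ht0
      · calc t z * K x z ≤ t z * (κ * jumpProfile d R₀ ell ‖z‖) :=
              mul_le_mul_of_nonneg_left hup ht0
          _ = jumpProfile d R₀ ell ‖z‖ * (κ * t z) := by ring
          _ ≤ _ := mul_le_mul_of_nonneg_left (le_max_left _ _) hJ
      · calc t z * K x z ≤ t z * (κ⁻¹ * jumpProfile d R₀ ell ‖z‖) :=
              mul_le_mul_of_nonpos_left hlo ht0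
          _ = jumpProfile d R₀ ell ‖z‖ * (κ⁻¹ * t z) := by ring
          _ ≤ _ := mul_le_mul_of_nonneg_left (le_max_right _ _) hJ
  refine (integral_mono hi (hp.add (hBi.const_mul M)) hpt).trans ?_
  have e := integral_add hp (hBi.const_mul M)
  rw [integral_const_mul] at e
  refine e.le.trans ?_
  have := mul_le_mul_of_nonneg_left hB hM
  linarith

end IsKernel

/-- A continuous function which is almost everywhere bounded below on an open set is bounded below
everywhere on this set. -/
theorem le_of_ae_le_of_isOpen {U : Set (𝔼 d)} (hU : IsOpen U) {φ : (𝔼 d) → ℝ}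
    (hφ : Continuous φ) {c : ℝ} (h : ∀ᵐ x ∂(volume.restrict U), c ≤ φ x) :
    ∀ x ∈ U, c ≤ φ x := by
  intro x hx
  by_contra! hcon
  have hV : IsOpen (U ∩ {y | φ y < c}) := hU.inter (isOpen_lt hφ continuous_const)
  rw [ae_restrict_iff' hU.measurableSet, ae_iff] at h
  have h0 : volume (U ∩ {y | φ y < c}) = 0 := by
    refine measure_mono_null (fun y hy => ?_) h
    simp only [Set.mem_ofPred_eq, not_forall, not_le]
    exact ⟨hy.1, hy.2⟩
  exact (hV.measure_pos volume ⟨x, hx, hcon⟩).ne' h0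

/-- A solution of the equation satisfies both extremal inequalities, at every point. -/
theorem IsKernel.extremal_inequalities {d : ℕ} {R₀ : ℝ≥0∞} {ell : ℝ → ℝ}
    {cL cU γ κ K₀ : ℝ} {K : EuclideanSpace ℝ (Fin d) → EuclideanSpace ℝ (Fin d) → ℝ}
    (hK : IsKernel d R₀ ell κ K₀ K)
    (h : IsScale d R₀ ell cL cU γ) (hd : 1 ≤ d) (hR₀ : 0 < R₀)
    (hκ : 1 ≤ κ) (hK₀ : 0 ≤ K₀) {u f : EuclideanSpace ℝ (Fin d) → ℝ}
    (hu : IsC2b u) {U : Set (EuclideanSpace ℝ (Fin d))} (hU : IsOpen U)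
    {F M B : ℝ} (hf : ∀ᵐ x ∂(volume.restrict U), |f x| ≤ F)
    (hAu : ∀ᵐ x ∂(volume.restrict U), nonlocalOp K u x = f x)
    (huM : ∀ x, |u x| ≤ M)
    (hB : ∀ x,
      Integrable ({h : EuclideanSpace ℝ (Fin d) | R₀ ≤ ENNReal.ofReal ‖h‖}.indicator
        (offDiagKernel K x)) ∧
      ∫ h, {h : EuclideanSpace ℝ (Fin d) | R₀ ≤ ENNReal.ofReal ‖h‖}.indicator
        (offDiagKernel K x) h ≤ B) :
    ∀ x ∈ U,
      -(2 * F + 4 * M * B) ≤ ∫ z, pucci κ (secondDiff u x z)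
          ∂(jumpMeasure d R₀ ell) ∧
      -(2 * F + 4 * M * B) ≤ ∫ z, pucci κ (-secondDiff u x z)
          ∂(jumpMeasure d R₀ ell) := by
  obtain ⟨C, _, hC⟩ := hu.exists_secondDiff_bound
  have hC' : ∀ x z, |-secondDiff u x z| ≤ C * min 1 (‖z‖ ^ 2) := fun x z => by
    rw [abs_neg]; exact hC x z
  have hM4 : ∀ x z, |secondDiff u x z| ≤ 4 * M := fun x z => by
    have h1 := abs_le.1 (huM (x + z))
    have h2 := abs_le.1 (huM (x - z))
    have h3 := abs_le.1 (huM x)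
    unfold secondDiff
    exact abs_le.2 ⟨by linarith, by linarith⟩
  have hc := continuous_secondDiff hu.contDiff.continuous
  have hm : ∀ x, Measurable (secondDiff u x) := fun x =>
    (hc.comp (continuous_const.prodMk continuous_id)).measurable
  intro x hx
  constructor
  -- The equation holds only almost everywhere, but the growth lemma evaluates the inequality at a
  -- maximum point; continuity upgrades it to every point of U.
  · refine le_of_ae_le_of_isOpen hU (h.continuous_integral_pucci hd hR₀ hκ hc hC) ?_
      x hx
    filter_upwards [hf, hAu] with y hy1 hy2
    have h1 := IsKernel.integral_mul_le h hd hR₀ hK hκ hK₀ y (hm y) (hC y) (hM4 y)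
      (hB y).1 (hB y).2
    rw [← hK.two_mul_nonlocalOp hK₀ hu, hy2] at h1
    linarith [(abs_le.1 hy1).1]
  · refine le_of_ae_le_of_isOpen hU
      (h.continuous_integral_pucci hd hR₀ hκ (t := fun x z => -secondDiff u x z)
        hc.neg hC') ?_ x hx
    filter_upwards [hf, hAu] with y hy1 hy2
    have h1 := IsKernel.integral_mul_le h hd hR₀ hK hκ hK₀ y (hm y).neg (hC' y)
      (fun z => by simpa only [abs_neg, Pi.neg_apply] using hM4 y z) (hB y).1 (hB y).2
    simp only [Pi.neg_apply, neg_mul, integral_neg] at h1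
    rw [← hK.two_mul_nonlocalOp hK₀ hu, hy2] at h1
    linarith [(abs_le.1 hy1).2]

end Reduction

end NonlocalReg

/-! ### Recentring and collection of constants. -/

theorem mainTheorem1 (d : ℕ) (hd : 1 ≤ d) (R₀ : ℝ≥0∞) (hR₀ : 0 < R₀)
    (ell : ℝ → ℝ) (cL cU γ : ℝ) (hell : NonlocalReg.IsScale d R₀ ell cL cU γ)
    (κ K₀ : ℝ) (hκ : 1 ≤ κ) (hK₀ : 1 ≤ K₀) :
    ∃ c β : ℝ, 0 < c ∧ 0 < β ∧ β < 1 ∧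
      ∀ K : EuclideanSpace ℝ (Fin d) → EuclideanSpace ℝ (Fin d) → ℝ,
        NonlocalReg.IsKernel d R₀ ell κ K₀ K →
      ∀ r : ℝ, 0 < r → (R₀ = ⊤ ∨ ENNReal.ofReal r ≤ R₀ / 2) →
      ∀ f : EuclideanSpace ℝ (Fin d) → ℝ,
        MemLp f ⊤ (volume.restrict (Metric.ball 0 r)) →
      ∀ u : EuclideanSpace ℝ (Fin d) → ℝ, NonlocalReg.IsC2b u →
        (∀ᵐ x ∂(volume.restrict (Metric.ball 0 r)), NonlocalReg.nonlocalOp K u x = f x) →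
      ∀ x ∈ Metric.ball (0 : EuclideanSpace ℝ (Fin d)) (r / 4),
      ∀ y ∈ Metric.ball (0 : EuclideanSpace ℝ (Fin d)) (r / 4), x ≠ y →
        |u x - u y| * NonlocalReg.scaleL R₀ ell ‖x - y‖ ^ β ≤
          c * NonlocalReg.scaleL R₀ ell r ^ β * (⨆ z, |u z|)
            + c * NonlocalReg.scaleL R₀ ell r ^ (β - 1)
              * (eLpNorm f ⊤ (volume.restrict (Metric.ball 0 r))).toReal := by
  have hK₀' : 0 ≤ K₀ := zero_le_one.trans hK₀
  obtain ⟨C, β, hC, hβ0, hβ1, hreg⟩ := hell.regularity_at_zero hd hκ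
  obtain ⟨T, hT, hfar⟩ := NonlocalReg.IsKernel.exists_far_mass (κ := κ) hell hR₀ hK₀'
  have hcL := hell.cL_pos
  set D : ℝ := 32 / cL ^ 2 + 1 with hD
  have hD1 : 1 ≤ D := by
    have : 0 < 32 / cL ^ 2 := by positivity
    linarith
  have hDβ : 0 < D ^ β := Real.rpow_pos_of_pos (by linarith) _
  refine ⟨C * D ^ β * (2 + 4 * T), β, by positivity, hβ0, hβ1, ?_⟩
  intro K hK r hr hrR f hf u hu hAu x hx y hy hxy
  have h2r : ENNReal.ofReal (2 * r) ≤ R₀ := by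
    rcases hrR with hrR | hrR
    · simp [hrR]
    · rw [ENNReal.ofReal_mul zero_le_two, ENNReal.ofReal_ofNat]
      calc 2 * ENNReal.ofReal r ≤ 2 * (R₀ / 2) := mul_le_mul_right hrR 2
        _ = R₀ := ENNReal.mul_div_cancel two_ne_zero ENNReal.ofNat_ne_top
  set L := NonlocalReg.scaleL R₀ ell r with hL
  have hLpos : 0 < L := hell.scaleL_pos hr h2r
  set F := (eLpNorm f ⊤ (volume.restrict (Metric.ball 0 r))).toReal with hF
  have hF0 : 0 ≤ F := ENNReal.toReal_nonneg
  have hfF : ∀ᵐ z ∂(volume.restrict (Metric.ball 0 r)), |f z| ≤ F := by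
    filter_upwards [ae_le_eLpNormEssSup (f := f) (μ := volume.restrict (Metric.ball 0 r))]
      with z hz
    rw [← eLpNorm_exponent_top] at hz
    have := ENNReal.toReal_mono hf.2.ne hz
    rwa [toReal_enorm, Real.norm_eq_abs] at this
  set M := ⨆ z, |u z| with hM
  have huM : ∀ z, |u z| ≤ M := by
    obtain ⟨C', _, hC', _⟩ := hu.exists_taylor_bound
    exact fun z => le_ciSup (f := fun z => |u z|) ⟨C', by rintro _ ⟨w, rfl⟩; exact hC' w⟩ z
  have hM0 : 0 ≤ M := (abs_nonneg _).trans (huM 0)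
  have hRHS : 0 ≤ C * D ^ β * (2 + 4 * T) * L ^ β * M
      + C * D ^ β * (2 + 4 * T) * L ^ (β - 1) * F := by
    positivity
  -- The estimate at the origin normalizes by a positive size, so u = 0 is treated apart.
  rcases hM0.eq_or_lt with hMz | hMpos
  · have hz : ∀ z, u z = 0 := fun z => abs_nonpos_iff.1 (hMz ▸ huM z)
    rw [hz x, hz y]
    simpa using hRHS
  have hext := hK.extremal_inequalities hell hd hR₀ hκ hK₀' hu Metric.isOpen_ball hfF hAu huM
    (B := T * L) (hfar K hK r hr h2r)
  obtain ⟨C', _, hC'⟩ := hu.exists_secondDiff_bound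
  have hc := NonlocalReg.continuous_secondDiff hu.contDiff.continuous
  have htrans : ∀ w, NonlocalReg.secondDiff (fun z => u (y + z)) w
      = NonlocalReg.secondDiff u (y + w) := by
    intro w; ext z; simp only [NonlocalReg.secondDiff, add_assoc, add_sub_assoc]
  rw [mem_ball_zero_iff] at hx hy
  have hball : ∀ w : EuclideanSpace ℝ (Fin d), ‖w‖ < r / 2 → y + w ∈ Metric.ball 0 r := by
    intro w hw
    rw [mem_ball_zero_iff]
    linarith [norm_add_le y w]
  -- For x, y in B_{r/4} the ball of radius r/2 about y lies in B_r and contains x, and 4ρ = 2r is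
  -- at most R₀. Doubling of L lets L(ρ) be replaced by L(r).
  set ρ := r / 2 with hρ
  have hρ0 : 0 < ρ := half_pos hr
  set G := 2 * F + 4 * M * (T * L) with hG
  have hG0 : 0 ≤ G := by positivity
  have key := hreg ρ hρ0 (by rwa [show 4 * ρ = 2 * r by rw [hρ]; ring])
    (fun z => u (y + z)) (hu.contDiff.continuous.comp (continuous_const.add continuous_id))
    (fun w => by
      rw [htrans]
      exact hell.integrable_of_le_min hd hR₀
        (hc.comp (continuous_const.prodMk continuous_id)).measurable (hC' _))
    M G hMpos (fun z => huM _) hG0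
    (fun w hw => by rw [htrans]; exact (hext _ (hball w hw)).1)
    (fun w hw => by rw [htrans]; exact (hext _ (hball w hw)).2)
    (x - y) (sub_ne_zero.2 hxy) (by linarith [norm_sub_le x y])
  simp only [add_sub_cancel, add_zero] at key
  refine key.trans ?_
  have hLρ1 : L ≤ NonlocalReg.scaleL R₀ ell ρ := hell.scaleL_anti hρ0 (by linarith)
  have hLρ2 : NonlocalReg.scaleL R₀ ell ρ ≤ D * L := by
    have := hell.scaleL_le_scaleL_two_mul hρ0 (by rwa [show 4 * ρ = 2 * r by rw [hρ]; ring])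
    rwa [show 2 * ρ = r by rw [hρ]; ring] at this
  have hLρ0 : 0 < NonlocalReg.scaleL R₀ ell ρ := hLpos.trans_le hLρ1
  have e1 : NonlocalReg.scaleL R₀ ell ρ ^ β ≤ D ^ β * L ^ β := by
    rw [← Real.mul_rpow (by linarith) hLpos.le]
    exact Real.rpow_le_rpow hLρ0.le hLρ2 hβ0.le
  have e2 : G / NonlocalReg.scaleL R₀ ell ρ ≤ G / L :=
    div_le_div_of_nonneg_left hG0 hLpos hLρ1
  have e3 : M + G / L ≤ (2 + 4 * T) * (M + F / L) := by
    have : G / L = 2 * (F / L) + 4 * M * T := by rw [hG]; field_simp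
    rw [this]
    have : 0 ≤ T * (F / L) := by positivity
    linarith
  have e4 : L ^ (β - 1) = L ^ β / L := Real.rpow_sub_one hLpos.ne' β
  have hLβ : 0 < L ^ β := Real.rpow_pos_of_pos hLpos _
  calc C * NonlocalReg.scaleL R₀ ell ρ ^ β * (M + G / NonlocalReg.scaleL R₀ ell ρ)
      ≤ C * (D ^ β * L ^ β) * ((2 + 4 * T) * (M + F / L)) := by
        refine mul_le_mul (mul_le_mul_of_nonneg_left e1 hC.le) (by linarith) (by positivity)
          (by positivity)
    _ = _ := by rw [e4]; ring
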